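/- Let $S^2$ be the unit sphere in $\mathbb{R}^3$, with surface area measure $\sigma$, and write $\mathrm{area}(A)=\sigma(A)$. For distinct non-antipodal points $x,y\in S^2$ let $[x,y]_s$ be the shorter arc of the great circle through $x$ and $y$ (and $[x,x]_s=\{x\}$). A set is spherically convex if it is contained in an open hemisphere and contains $[x,y]_s$ for all its points $x,y$; a convex disk is a compact spherically convex set $K\subset S^2$ with nonempty interior. The spherical convex hull of a set contained in an open hemisphere is the intersection of all spherically convex sets containing it, and a spherical triangle is the spherical convex hull of three points that do not lie on a common great circle. The spherical centroid of a Borel set $A\subset S^2$ with $\sigma(A)>0$ is \[ g_s(A)=\frac{\int_A u\,d\sigma(u)}{\left\|\int_A u\,d\sigma(u)\right\|}, \] provided the denominator is nonzero. Theorem. Let $K\subset S^2$ be a convex disk with spherical centroid $c$. Let $L$ be a great circle through $c$, and let $S_1$ and $S_2$ be the two closed hemispheres bounded by $L$. Put $K_1=K\cap S_1$ and $K_2=K\cap S_2$. Then there is a spherical triangle $T$ with spherical centroid $c$ such that, with $T_1=T\cap S_1$ and $T_2=T\cap S_2$, \[ \frac{\mathrm{area}(K_2)}{\mathrm{area}(K_1)}\le\frac{\mathrm{area}(T_2)}{\mathrm{area}(T_1)}.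 \] -/

import Mathlib

open MeasureTheory

noncomputable section

/-- The unit sphere `S²` of `ℝ³`, centred at the origin. -/
abbrev Sph2 : Type := Metric.sphere (0 : EuclideanSpace ℝ (Fin 3)) 1

namespace Sph2

/-- Spherical distance: the arccosine of the inner product. -/
def sdist (x y : Sph2) : ℝ :=
  Real.arccos (inner ℝ (x : EuclideanSpace ℝ (Fin 3)) (y : EuclideanSpace ℝ (Fin 3)))

/-- The open hemisphere with centre `u`: the open spherical ball of radius `π / 2`. -/
def openHemisphere (u : Sph2) : Set Sph2 := {x | sdist u x < Real.pi / 2}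

/-- The closed hemisphere with centre `u`: the closed spherical ball of radius `π / 2`. -/
def closedHemisphere (u : Sph2) : Set Sph2 := {x | sdist u x ≤ Real.pi / 2}

/-- A great circle: the intersection of the sphere with a plane through the origin. -/
def IsGreatCircle (L : Set Sph2) : Prop :=
  ∃ W : Submodule ℝ (EuclideanSpace ℝ (Fin 3)),
    Module.finrank ℝ W = 2 ∧ L = {x : Sph2 | (x : EuclideanSpace ℝ (Fin 3)) ∈ W}

/-- The spherical segment with endpoints `x`, `y` (used for `y ≠ -x`): the shorter arc of the great
circle through `x` and `y`, that is, the points of the sphere in the cone spanned by `x` and `y`. -/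
def segment (x y : Sph2) : Set Sph2 :=
  {z | ∃ a b : ℝ, 0 ≤ a ∧ 0 ≤ b ∧
    (z : EuclideanSpace ℝ (Fin 3)) =
      a • (x : EuclideanSpace ℝ (Fin 3)) + b • (y : EuclideanSpace ℝ (Fin 3))}

/-- Spherically convex sets: contained in an open hemisphere, and containing the segment between
any two of their points. -/
def IsConvex (K : Set Sph2) : Prop :=
  (∃ u : Sph2, K ⊆ openHemisphere u) ∧ ∀ x ∈ K, ∀ y ∈ K, segment x y ⊆ K

/-- The spherical convex hull of a set that lies in an open hemisphere. -/
def convHull (A : Set Sph2) : Set Sph2 := ⋂₀ {C | IsConvex C ∧ A ⊆ C}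

/-- A convex disk: a compact spherically convex set with nonempty interior (relative to `S²`). -/
structure IsConvexDisk (K : Set Sph2) : Prop where
  isCompact : IsCompact K
  isConvex : IsConvex K
  nonempty_interior : (interior K).Nonempty

/-- A (nondegenerate) spherical triangle: the spherical convex hull of three points that do not lie
on a common great circle. Three such points always lie in a common open hemisphere. -/
def IsTriangle (T : Set Sph2) : Prop :=
  ∃ p : Fin 3 → Sph2,
    LinearIndependent ℝ (fun i => (p i : EuclideanSpace ℝ (Fin 3))) ∧
      T = convHull (Set.range p)

/-- The spherical Lebesgue (surface area) measure on `S²`, of total mass `4π`. -/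
def σ : Measure Sph2 := (volume : Measure (EuclideanSpace ℝ (Fin 3))).toSphere

/-- Spherical area. -/
def area (A : Set Sph2) : ℝ := σ.real A

/-- The vector-valued first moment `∫_A u dσ(u)`. -/
def moment (A : Set Sph2) : EuclideanSpace ℝ (Fin 3) :=
  ∫ u in A, (u : EuclideanSpace ℝ (Fin 3)) ∂σ

/-- `c` is the spherical centroid of `A`: `A` is a Borel set of positive measure with nonzero first
moment, and `c` is the normalized first moment. -/
structure IsCentroid (A : Set Sph2) (c : Sph2) : Prop where
  measurableSet : MeasurableSet A
  pos : 0 < σ A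
  moment_ne_zero : moment A ≠ 0
  eq : (c : EuclideanSpace ℝ (Fin 3)) = ‖moment A‖⁻¹ • moment A

end Sph2

end

/-! The number 5/4 separates the two sides. Every convex disk satisfies area(K₂)/area(K₁) < 5/4
strictly (`InFrame.area_lt`), while small isosceles triangles with centroid c have ratios
arbitrarily close to 5/4, the value attained by planar triangles cut parallel to a side
(`exists_triangle`). So a sufficiently small triangle beats the ratio of K.

For the strict bound, take c as first frame vector and the pole of S₂ as third. A reflection
argument puts K in the open hemisphere about c (`IsConvexDisk.inner_centroid_pos`), and separation
puts c in the interior of the cone over K (`IsConvexDisk.centroid_mem_interior_cone`). In longitude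
and height coordinates the area is Lebesgue measure (`sigma_restrict_eq_map_cyl`), so the problem
becomes one-dimensional. Let f x and g x be the lengths of the slices of K at heights −x and x, and
w their common value at 0. Since c lies on L, the moments ∫ x f and ∫ x g over x > 0 agree. Planar
profiles would be concave; on the sphere, convexity yields two substitutes that suffice,
`InFrame.profile_ge` and `InFrame.profile_le`.

Let A = ∫ f and let H = 2A/w be the height of the triangle with base w and area A. By the first
substitute f crosses the line w(1 − x/H) only once, from above to below, so its moment is less than
wH²/6 (`moment_lt_of_profile`). By the second, g cannot exceed the continued line w(1 + x/H) at any
x ≤ H/2, since otherwise f would have area less than A (`upper_profile_le`). The trapezoid under the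
continued line on (0, H/2] has moment exactly wH²/6 and area 5A/4. As g lies below it up to H/2 and
has smaller moment, its area is smaller (`area_lt_of_profiles`). -/

open scoped Pointwise

namespace Sph2

local notation "E3" => EuclideanSpace ℝ (Fin 3)

/-! ### Gnomonic coordinates and their area density -/

section

/-- The vector with coordinates `p` in the orthonormal frame `b`. -/
noncomputable def frameVec (b : OrthonormalBasis (Fin 3) ℝ (EuclideanSpace ℝ (Fin 3)))
    (p : ℝ × ℝ × ℝ) : EuclideanSpace ℝ (Fin 3) :=
  p.1 • b 0 + p.2.1 • b 1 + p.2.2 • b 2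

variable (b : OrthonormalBasis (Fin 3) ℝ (EuclideanSpace ℝ (Fin 3)))

lemma continuous_frameVec : Continuous (frameVec b) := by
  unfold frameVec; fun_prop

lemma inner_frame_zero (p : ℝ × ℝ × ℝ) : inner ℝ (b 0) (frameVec b p) = p.1 := by
  simp [frameVec, inner_add_right, inner_smul_right, b.inner_eq_ite]

lemma inner_frame_one (p : ℝ × ℝ × ℝ) : inner ℝ (b 1) (frameVec b p) = p.2.1 := by
  simp [frameVec, inner_add_right, inner_smul_right, b.inner_eq_ite]

lemma inner_frame_two (p : ℝ × ℝ × ℝ) : inner ℝ (b 2) (frameVec b p) = p.2.2 := by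
  simp [frameVec, inner_add_right, inner_smul_right, b.inner_eq_ite]

lemma frameVec_inner (x : EuclideanSpace ℝ (Fin 3)) :
    frameVec b (inner ℝ (b 0) x, inner ℝ (b 1) x, inner ℝ (b 2) x) = x := by
  conv_rhs => rw [← b.sum_repr x]
  simp [frameVec, Fin.sum_univ_three, b.repr_apply_apply]

lemma frameVec_injective : Function.Injective (frameVec b) := by
  intro p q h
  ext
  · rw [← inner_frame_zero b p, h, inner_frame_zero]
  · rw [← inner_frame_one b p, h, inner_frame_one]
  · rw [← inner_frame_two b p, h, inner_frame_two]

lemma norm_sq_frameVec (p : ℝ × ℝ × ℝ) :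
    ‖frameVec b p‖ ^ 2 = p.1 ^ 2 + p.2.1 ^ 2 + p.2.2 ^ 2 := by
  rw [← b.sum_sq_norm_inner_right (frameVec b p)]
  simp [Fin.sum_univ_three, inner_frame_zero, inner_frame_one, inner_frame_two]

lemma frameVec_smul (r : ℝ) (p : ℝ × ℝ × ℝ) : frameVec b (r • p) = r • frameVec b p := by
  simp [frameVec, smul_smul]

lemma frameVec_add (p q : ℝ × ℝ × ℝ) : frameVec b (p + q) = frameVec b p + frameVec b q := by
  simp only [frameVec, Prod.fst_add, Prod.snd_add, add_smul]; abel

lemma measurePreserving_frameVec : MeasurePreserving (frameVec b) volume volume := by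
  have h1 := (volume_preserving_piFinSuccAbove (fun _ : Fin 3 => ℝ) 0).symm
  have h2 := (volume_preserving_piFinTwo (fun _ : Fin 2 => ℝ)).symm
  have h3 : MeasurePreserving (Prod.map (id : ℝ → ℝ) (MeasurableEquiv.piFinTwo
      (fun _ : Fin 2 => ℝ)).symm) volume volume := (MeasurePreserving.id _).prod h2
  have h4 := (b.measurePreserving_repr_symm.comp (EuclideanSpace.volume_preserving_symm_measurableEquiv_toLp (Fin 3)).symm).comp (h1.comp h3)
  convert h4 using 1
  ext1 p
  apply b.repr.injective
  ext i
  simp only [frameVec, Function.comp]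
  erw [LinearIsometryEquiv.apply_symm_apply]
  fin_cases i <;> simp

/-- The density factor of the gnomonic projection. -/
noncomputable def gw (p : ℝ × ℝ) : ℝ := (√(1 + p.1 ^ 2 + p.2 ^ 2))⁻¹

lemma gw_pos (p : ℝ × ℝ) : 0 < gw p := by unfold gw; positivity

lemma continuous_gw : Continuous gw := by
  unfold gw
  refine Continuous.inv₀ (by fun_prop) fun p => by positivity

/-- The inverse of the gnomonic projection onto the plane tangent at `b 0`. -/
noncomputable def gno (p : ℝ × ℝ) : Sph2 :=
  ⟨gw p • frameVec b (1, p.1, p.2), by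
    have h := norm_sq_frameVec b (1, p.1, p.2)
    have h2 : ‖frameVec b (1, p.1, p.2)‖ = √(1 + p.1 ^ 2 + p.2 ^ 2) := by
      rw [← Real.sqrt_sq (norm_nonneg _), h]; simp
    have h3 : √(1 + p.1 ^ 2 + p.2 ^ 2) ≠ 0 := by positivity
    rw [mem_sphere_zero_iff_norm, norm_smul, h2, Real.norm_of_nonneg (gw_pos p).le, gw,
      inv_mul_cancel₀ h3]⟩

lemma coe_gno (p : ℝ × ℝ) :
    (gno b p : EuclideanSpace ℝ (Fin 3)) = gw p • frameVec b (1, p.1, p.2) := rfl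

lemma continuous_gno : Continuous (gno b) := by
  refine Continuous.subtype_mk (continuous_gw.smul ((continuous_frameVec b).comp (by fun_prop))) _

lemma inner_gno_zero (p : ℝ × ℝ) : inner ℝ (b 0) (gno b p : EuclideanSpace ℝ (Fin 3)) = gw p := by
  rw [coe_gno, inner_smul_right, inner_frame_zero, mul_one]

lemma inner_gno_one (p : ℝ × ℝ) :
    inner ℝ (b 1) (gno b p : EuclideanSpace ℝ (Fin 3)) = gw p * p.1 := by
  rw [coe_gno, inner_smul_right, inner_frame_one]

lemma inner_gno_two (p : ℝ × ℝ) :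
    inner ℝ (b 2) (gno b p : EuclideanSpace ℝ (Fin 3)) = gw p * p.2 := by
  rw [coe_gno, inner_smul_right, inner_frame_two]

lemma eq_gno_of_pos {u : Sph2} (hu : 0 < inner ℝ (b 0) (u : EuclideanSpace ℝ (Fin 3))) :
    u = gno b (inner ℝ (b 1) (u : EuclideanSpace ℝ (Fin 3)) / inner ℝ (b 0) u.1,
      inner ℝ (b 2) (u : EuclideanSpace ℝ (Fin 3)) / inner ℝ (b 0) u.1) := by
  have h1 : ‖(u : EuclideanSpace ℝ (Fin 3))‖ = 1 := mem_sphere_zero_iff_norm.1 u.2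
  have h2 := norm_sq_frameVec b (inner ℝ (b 0) u.1, inner ℝ (b 1) u.1, inner ℝ (b 2) u.1)
  rw [frameVec_inner, h1] at h2
  set x : ℝ := inner ℝ (b 0) u.1
  set y : ℝ := inner ℝ (b 1) u.1
  set z : ℝ := inner ℝ (b 2) u.1
  have h3 : gw (y / x, z / x) = x := by
    have : 1 + (y / x) ^ 2 + (z / x) ^ 2 = (x⁻¹) ^ 2 := by
      field_simp; simp at h2; linarith
    rw [gw]; dsimp only
    rw [this, Real.sqrt_sq (by positivity), inv_inv]
  apply Subtype.ext
  rw [coe_gno, h3, ← frameVec_smul]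
  conv_lhs => rw [← frameVec_inner b u.1]
  congr 1
  have hx : x ≠ 0 := hu.ne'
  ext <;> simp only [Prod.smul_mk, smul_eq_mul, mul_one, x, y, z] <;> exact (mul_div_cancel₀ _ hx).symm

lemma lintegral_sq_Ioo {w : ℝ} (hw : 0 ≤ w) :
    ∫⁻ l in Set.Ioo 0 w, ENNReal.ofReal (l ^ 2) = ENNReal.ofReal (w ^ 3 / 3) := by
  rw [Measure.restrict_congr_set Ioo_ae_eq_Ioc, ← ofReal_integral_eq_lintegral_ofReal,
    ← intervalIntegral.integral_of_le hw]
  · norm_num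
  · exact (intervalIntegral.intervalIntegrable_pow 2).1
  · exact Filter.Eventually.of_forall fun x => sq_nonneg x

lemma sigma_apply {A : Set Sph2} (hA : MeasurableSet A) :
    σ A = 3 * volume (Set.Ioo (0 : ℝ) 1 • ((↑) '' A : Set (EuclideanSpace ℝ (Fin 3)))) := by
  rw [σ, Measure.toSphere_apply' _ hA]; simp

/-- The measure of A is three times the volume of the solid cone over A. The section of this cone at
first coordinate l is l times a planar set, and the direction p occurs in it exactly for l < gw p.
Tonelli and ∫ l² dl = gw³/3 over (0, gw p) produce the density gw³. -/
lemma sigma_eq_lintegral_gno {A : Set Sph2} (hA : MeasurableSet A)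
    (hpos : ∀ u ∈ A, 0 < inner ℝ (b 0) (u : EuclideanSpace ℝ (Fin 3))) :
    σ A = ∫⁻ p, (gno b ⁻¹' A).indicator (fun p => ENNReal.ofReal (gw p ^ 3)) p := by
  have hgA : MeasurableSet (gno b ⁻¹' A) := (continuous_gno b).measurable hA
  have hgwm : Measurable gw := continuous_gw.measurable
  set S : Set (ℝ × ℝ × ℝ) := {p | 0 < p.1 ∧ p.1 < gw (p.1⁻¹ • p.2) ∧ p.1⁻¹ • p.2 ∈ gno b ⁻¹' A}
    with hS
  have hsm : Measurable fun p : ℝ × ℝ × ℝ => p.1⁻¹ • p.2 := by fun_prop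
  have hSm : MeasurableSet S :=
    (measurableSet_lt measurable_const measurable_fst).inter
      ((measurableSet_lt measurable_fst (hgwm.comp hsm)).inter (hsm hgA))
  have hpre : frameVec b ⁻¹' (Set.Ioo (0 : ℝ) 1 • ((↑) '' A : Set (EuclideanSpace ℝ (Fin 3)))) = S := by
    ext ⟨l, x, y⟩
    simp only [Set.mem_preimage, Set.mem_smul, hS, Set.mem_ofPred_eq, Set.mem_image]
    constructor
    · rintro ⟨r, ⟨hr0, hr1⟩, _, ⟨u, hu, rfl⟩, h⟩
      have hu0 := hpos u hu
      have e0 := congrArg (fun v => inner ℝ (b 0) v) h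
      have e1 := congrArg (fun v => inner ℝ (b 1) v) h
      have e2 := congrArg (fun v => inner ℝ (b 2) v) h
      simp only [inner_smul_right, inner_frame_zero, inner_frame_one, inner_frame_two] at e0 e1 e2
      have hl : 0 < l := e0 ▸ mul_pos hr0 hu0
      have hq : l⁻¹ • (x, y) = (inner ℝ (b 1) (u : EuclideanSpace ℝ (Fin 3)) / inner ℝ (b 0) u.1,
          inner ℝ (b 2) (u : EuclideanSpace ℝ (Fin 3)) / inner ℝ (b 0) u.1) := by
        ext <;> simp only [Prod.smul_mk, smul_eq_mul, ← e0, ← e1, ← e2] <;> field_simp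
      have hu' := eq_gno_of_pos b hu0
      rw [← hq] at hu'
      refine ⟨hl, ?_, hu' ▸ hu⟩
      rw [← inner_gno_zero b, ← hu', ← e0]
      nlinarith
    · rintro ⟨hl, h1, h2⟩
      refine ⟨l / gw (l⁻¹ • (x, y)), ⟨div_pos hl (gw_pos _), (div_lt_one (gw_pos _)).2 h1⟩, _,
        ⟨_, h2, rfl⟩, ?_⟩
      rw [coe_gno, smul_smul, div_mul_cancel₀ _ (gw_pos _).ne', ← frameVec_smul]
      congr 1
      ext <;> simp [hl.ne']
  rw [sigma_apply hA, ← (measurePreserving_frameVec b).measure_preimage_emb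
    ((continuous_frameVec b).measurableEmbedding (frameVec_injective b)), hpre,
    Measure.volume_eq_prod, Measure.prod_apply hSm]
  -- T is S after division of the last two coordinates by the first, which costs a factor l² on each
  -- section.
  set T : Set (ℝ × ℝ × ℝ) := {p | 0 < p.1 ∧ p.1 < gw p.2 ∧ p.2 ∈ gno b ⁻¹' A} with hT
  have hTm : MeasurableSet T :=
    (measurableSet_lt measurable_const measurable_fst).inter
      ((measurableSet_lt measurable_fst (hgwm.comp measurable_snd)).inter (measurable_snd hgA))
  have h1 : ∀ l : ℝ, volume (Prod.mk l ⁻¹' S) =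
      ∫⁻ q, T.indicator (fun p => ENNReal.ofReal (p.1 ^ 2)) (l, q) := by
    intro l
    by_cases hl : 0 < l
    · have e1 : Prod.mk l ⁻¹' S = (fun q : ℝ × ℝ => l⁻¹ • q) ⁻¹' (Prod.mk l ⁻¹' T) := by
        ext q; simp [hS, hT]
      have e2 : ∀ q, T.indicator (fun p => ENNReal.ofReal (p.1 ^ 2)) (l, q) =
          (Prod.mk l ⁻¹' T).indicator (fun _ => ENNReal.ofReal (l ^ 2)) q := fun q => rfl
      simp_rw [e2]
      rw [lintegral_indicator (measurable_prodMk_left hTm), setLIntegral_const, e1,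
        Measure.addHaar_preimage_smul _ (inv_ne_zero hl.ne')]
      congr 2
      simp [abs_of_pos hl]
    · have e1 : Prod.mk l ⁻¹' S = ∅ := by ext q; simp [hS, hl]
      have e2 : ∀ q, T.indicator (fun p => ENNReal.ofReal (p.1 ^ 2)) (l, q) = 0 := fun q =>
        Set.indicator_of_notMem (by simp [hT, hl]) _
      simp [e1, e2]
  simp_rw [h1]
  rw [lintegral_lintegral_swap, ← lintegral_const_mul]
  · congr 1
    ext q
    by_cases hq : q ∈ gno b ⁻¹' A
    · rw [Set.indicator_of_mem hq]
      have e2 : ∀ l, T.indicator (fun p => ENNReal.ofReal (p.1 ^ 2)) (l, q) =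
          (Set.Ioo 0 (gw q)).indicator (fun l => ENNReal.ofReal (l ^ 2)) l := by
        intro l
        by_cases hl : l ∈ Set.Ioo 0 (gw q)
        · rw [Set.indicator_of_mem hl, Set.indicator_of_mem (show (l, q) ∈ T from ⟨hl.1, hl.2, hq⟩)]
        · rw [Set.indicator_of_notMem hl, Set.indicator_of_notMem fun h => hl ⟨h.1, h.2.1⟩]
      simp_rw [e2]
      rw [lintegral_indicator measurableSet_Ioo, lintegral_sq_Ioo (gw_pos q).le,
        show (3 : ENNReal) = ENNReal.ofReal 3 by simp, ← ENNReal.ofReal_mul (by norm_num)]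
      congr 1; ring
    · rw [Set.indicator_of_notMem hq]
      have e2 : ∀ l, T.indicator (fun p => ENNReal.ofReal (p.1 ^ 2)) (l, q) = 0 := fun l =>
        Set.indicator_of_notMem (fun h => hq h.2.2) _
      simp [e2]
  · exact (Measurable.indicator (by fun_prop) hTm).lintegral_prod_left'
  · exact (Measurable.indicator (by fun_prop) hTm).aemeasurable

lemma sigma_restrict_eq_map_gno :
    σ.restrict {u : Sph2 | 0 < inner ℝ (b 0) (u : EuclideanSpace ℝ (Fin 3))} =
      (volume.withDensity fun p => ENNReal.ofReal (gw p ^ 3)).map (gno b) := by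
  ext A hA
  have hH : MeasurableSet {u : Sph2 | 0 < inner ℝ (b 0) (u : EuclideanSpace ℝ (Fin 3))} :=
    measurableSet_lt measurable_const (by fun_prop)
  have hgA : MeasurableSet (gno b ⁻¹' A) := (continuous_gno b).measurable hA
  rw [Measure.restrict_apply hA, sigma_eq_lintegral_gno b (hA.inter hH) fun u hu => hu.2,
    Measure.map_apply (continuous_gno b).measurable hA, withDensity_apply _ hgA,
    ← lintegral_indicator hgA]
  congr 1
  ext p
  have : gno b ⁻¹' (A ∩ {u : Sph2 | 0 < inner ℝ (b 0) (u : EuclideanSpace ℝ (Fin 3))}) =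
      gno b ⁻¹' A := by
    ext p; simp [inner_gno_zero, gw_pos]
  rw [this]

instance : IsFiniteMeasure σ := by unfold σ; infer_instance

instance : σ.IsOpenPosMeasure := by unfold σ; infer_instance

end

/-! ### Longitude and height: the equal-area cylindrical projection -/

section

variable (b : OrthonormalBasis (Fin 3) ℝ (EuclideanSpace ℝ (Fin 3)))

/-- The tangent of the angle with sine `z`. -/
noncomputable def tanArcsin (z : ℝ) : ℝ := z / √(1 - z ^ 2)

lemma sqrt_one_sub_sq_pos {z : ℝ} (hz : z ∈ Set.Ioo (-1 : ℝ) 1) : 0 < √(1 - z ^ 2) :=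
  Real.sqrt_pos.2 (by nlinarith [hz.1, hz.2])

lemma sq_sqrt_one_sub_sq {z : ℝ} (hz : z ∈ Set.Ioo (-1 : ℝ) 1) : √(1 - z ^ 2) ^ 2 = 1 - z ^ 2 :=
  Real.sq_sqrt (by nlinarith [hz.1, hz.2])

lemma hasDerivAt_tanArcsin {z : ℝ} (hz : z ∈ Set.Ioo (-1 : ℝ) 1) :
    HasDerivAt tanArcsin ((√(1 - z ^ 2) ^ 3)⁻¹) z := by
  have h0 := sqrt_one_sub_sq_pos hz
  have h1 := sq_sqrt_one_sub_sq hz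
  have h2 : HasDerivAt (fun z : ℝ => 1 - z ^ 2) (-(2 * z)) z := by
    simpa using (hasDerivAt_pow 2 z).const_sub 1
  have h3 := (hasDerivAt_id z).div (h2.sqrt (by nlinarith [hz.1, hz.2])) h0.ne'
  refine h3.congr_deriv ?_
  simp only [id]
  field_simp
  linarith

lemma strictMonoOn_tanArcsin : StrictMonoOn tanArcsin (Set.Ioo (-1) 1) := by
  refine strictMonoOn_of_deriv_pos (convex_Ioo _ _)
    (fun z hz => (hasDerivAt_tanArcsin hz).continuousAt.continuousWithinAt) fun z hz => ?_
  rw [interior_Ioo] at hz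
  rw [(hasDerivAt_tanArcsin hz).deriv]
  have := sqrt_one_sub_sq_pos hz
  positivity

lemma sqrt_eq_of_sq_eq {x y : ℝ} (hy : 0 ≤ y) (h : x = y ^ 2) : √x = y := by
  rw [h, Real.sqrt_sq hy]

lemma image_mul_tanArcsin {k : ℝ} (hk : 0 < k) :
    (fun z => k * tanArcsin z) '' Set.Ioo (-1) 1 = Set.univ := by
  refine Set.eq_univ_of_forall fun y => ⟨y / √(k ^ 2 + y ^ 2), ?_, ?_⟩
  · have h : |y| < √(k ^ 2 + y ^ 2) := by
      rw [← Real.sqrt_sq_eq_abs]; exact Real.sqrt_lt_sqrt (sq_nonneg _) (by nlinarith)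
    have h0 : 0 < √(k ^ 2 + y ^ 2) := by positivity
    have h2 := abs_lt.1 h
    constructor
    · rw [lt_div_iff₀ h0]; linarith
    · rw [div_lt_one h0]; exact h2.2
  · have h0 : 0 < √(k ^ 2 + y ^ 2) := by positivity
    have h1 : √(1 - (y / √(k ^ 2 + y ^ 2)) ^ 2) = k / √(k ^ 2 + y ^ 2) := by
      refine sqrt_eq_of_sq_eq (by positivity) ?_
      rw [div_pow, div_pow, Real.sq_sqrt (by positivity)]
      field_simp; ring
    simp only [tanArcsin, h1]
    field_simp

lemma gw_mul_tanArcsin (X : ℝ) {z : ℝ} (hz : z ∈ Set.Ioo (-1 : ℝ) 1) :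
    gw (X, √(1 + X ^ 2) * tanArcsin z) = √(1 - z ^ 2) / √(1 + X ^ 2) := by
  have h0 := sqrt_one_sub_sq_pos hz
  have h1 := sq_sqrt_one_sub_sq hz
  have h3 : 0 < √(1 + X ^ 2) := by positivity
  have h4 : √(1 + X ^ 2) ^ 2 = 1 + X ^ 2 := Real.sq_sqrt (by positivity)
  rw [gw, ← inv_div]
  congr 1
  refine sqrt_eq_of_sq_eq (by positivity) ?_
  simp only [tanArcsin]
  rw [div_pow, mul_pow, div_pow, h1, h4]
  have : 1 - z ^ 2 ≠ 0 := by rw [← h1]; positivity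
  field_simp
  ring

/-- The substitution Y = √(1 + X²) · tan(latitude), with z the sine of the latitude, has Jacobian
√(1 + X²)(1 − z²)^(−3/2). This cancels the dependence on z of the density (1 − z²)^(3/2)(1 +
X²)^(−3/2). -/
lemma lintegral_gw_inner (X : ℝ) (F : ℝ → ENNReal) :
    ∫⁻ Y, F Y * ENNReal.ofReal (gw (X, Y) ^ 3) =
      ∫⁻ z in Set.Ioo (-1) 1, F (√(1 + X ^ 2) * tanArcsin z) *
        ENNReal.ofReal ((1 + X ^ 2)⁻¹) := by
  have hk : 0 < √(1 + X ^ 2) := by positivity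
  rw [← setLIntegral_univ, ← image_mul_tanArcsin hk,
    lintegral_image_eq_lintegral_abs_deriv_mul measurableSet_Ioo
      (fun z hz => ((hasDerivAt_tanArcsin hz).const_mul _).hasDerivWithinAt)]
  · refine setLIntegral_congr_fun measurableSet_Ioo fun z hz => ?_
    have h0 := sqrt_one_sub_sq_pos hz
    have h4 : √(1 + X ^ 2) ^ 2 = 1 + X ^ 2 := Real.sq_sqrt (by positivity)
    rw [gw_mul_tanArcsin X hz, mul_left_comm, ← ENNReal.ofReal_mul (by positivity)]
    congr 2
    rw [abs_of_pos (by positivity)]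
    field_simp
    rw [h4]
  · intro x hx y hy h
    exact strictMonoOn_tanArcsin.injOn hx hy (mul_left_cancel₀ hk.ne' h)

/-- Longitude and height coordinates, in gnomonic coordinates. -/
noncomputable def lonHeight (p : ℝ × ℝ) : ℝ × ℝ :=
  (Real.tan p.1, √(1 + Real.tan p.1 ^ 2) * tanArcsin p.2)

lemma measurable_tan' : Measurable Real.tan := by
  have : Real.tan = fun x => Real.sin x / Real.cos x := funext Real.tan_eq_sin_div_cos
  rw [this]; fun_prop

lemma measurable_tanArcsin : Measurable tanArcsin := by unfold tanArcsin; fun_prop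

lemma measurable_lonHeight : Measurable lonHeight := by
  have h1 := measurable_tan'
  have h2 := measurable_tanArcsin
  unfold lonHeight; fun_prop

/-- The open rectangle of longitudes and heights. -/
def cylDom : Set (ℝ × ℝ) := Set.Ioo (-(Real.pi / 2)) (Real.pi / 2) ×ˢ Set.Ioo (-1) 1

/-- The factor 1/(1 + X²) left by the inner substitution is the derivative of arctan, so X = tan t
turns the density into 1. -/
lemma lintegral_gw_eq (F : ℝ × ℝ → ENNReal) (hF : Measurable F) :
    ∫⁻ p, F p * ENNReal.ofReal (gw p ^ 3) = ∫⁻ p in cylDom, F (lonHeight p) := by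
  have hgw := continuous_gw.measurable
  rw [Measure.volume_eq_prod, cylDom, ← Measure.prod_restrict,
    lintegral_prod _ (by fun_prop),
    lintegral_prod (fun p => F (lonHeight p)) (hF.comp measurable_lonHeight).aemeasurable]
  simp_rw [fun X => lintegral_gw_inner X fun Y => F (X, Y)]
  have him : Real.tan '' Set.Ioo (-(Real.pi / 2)) (Real.pi / 2) = Set.univ :=
    Set.eq_univ_of_univ_subset Real.surjOn_tan
  rw [← setLIntegral_univ, ← him,
    lintegral_image_eq_lintegral_abs_deriv_mul measurableSet_Ioo
      (fun t ht => (Real.hasDerivAt_tan_of_mem_Ioo ht).hasDerivWithinAt) Real.injOn_tan]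
  refine setLIntegral_congr_fun measurableSet_Ioo fun t ht => ?_
  have hc := Real.cos_pos_of_mem_Ioo ht
  have h2 := measurable_tanArcsin
  rw [lintegral_mul_const _ (by fun_prop), mul_left_comm, ← ENNReal.ofReal_mul (by positivity)]
  have : |1 / Real.cos t ^ 2| * (1 + Real.tan t ^ 2)⁻¹ = 1 := by
    rw [abs_of_pos (by positivity), Real.inv_one_add_tan_sq hc.ne']
    field_simp
  rw [this]
  simp [lonHeight]

/-- The point of the sphere with given longitude and height. -/
noncomputable def cyl (p : ℝ × ℝ) : Sph2 := gno b (lonHeight p)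

lemma measurable_cyl : Measurable (cyl b) :=
  (continuous_gno b).measurable.comp measurable_lonHeight

/-- Archimedes' theorem: projecting the sphere to the circumscribed cylinder preserves area. -/
lemma sigma_restrict_eq_map_cyl :
    σ.restrict {u : Sph2 | 0 < inner ℝ (b 0) (u : EuclideanSpace ℝ (Fin 3))} =
      (volume.restrict cylDom).map (cyl b) := by
  rw [sigma_restrict_eq_map_gno]
  ext A hA
  have hgA : MeasurableSet (gno b ⁻¹' A) := (continuous_gno b).measurable hA
  rw [Measure.map_apply (continuous_gno b).measurable hA, withDensity_apply _ hgA,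
    Measure.map_apply (measurable_cyl b) hA, ← lintegral_indicator hgA]
  have h := lintegral_gw_eq ((gno b ⁻¹' A).indicator 1) (measurable_one.indicator hgA)
  have e1 : ∀ p, (gno b ⁻¹' A).indicator 1 p * ENNReal.ofReal (gw p ^ 3) =
      (gno b ⁻¹' A).indicator (fun p => ENNReal.ofReal (gw p ^ 3)) p := by
    intro p; by_cases hp : p ∈ gno b ⁻¹' A <;> simp [hp]
  simp_rw [e1] at h
  rw [h]
  have e2 : ∀ p, (gno b ⁻¹' A).indicator (1 : ℝ × ℝ → ENNReal) (lonHeight p) =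
      (cyl b ⁻¹' A).indicator 1 p := fun p => rfl
  simp_rw [e2]
  rw [lintegral_indicator_one (measurable_cyl b hA)]

lemma coe_cyl {p : ℝ × ℝ} (hp : p ∈ cylDom) :
    (cyl b p : EuclideanSpace ℝ (Fin 3)) =
      √(1 - p.2 ^ 2) • frameVec b (Real.cos p.1, Real.sin p.1, tanArcsin p.2) := by
  have hc := Real.cos_pos_of_mem_Ioo hp.1
  have h1 : √(1 + Real.tan p.1 ^ 2) = (Real.cos p.1)⁻¹ := by
    refine sqrt_eq_of_sq_eq (by positivity) ?_
    rw [inv_pow, ← Real.inv_one_add_tan_sq hc.ne', inv_inv]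
  rw [cyl, coe_gno, lonHeight, gw_mul_tanArcsin _ hp.2, h1, div_inv_eq_mul, mul_smul,
    ← frameVec_smul]
  congr 2
  ext
  · simp
  · simp [mul_comm (Real.cos p.1), Real.tan_mul_cos hc.ne']
  · simp [mul_inv_cancel_left₀ hc.ne']

lemma inner_cyl_two {p : ℝ × ℝ} (hp : p ∈ cylDom) :
    inner ℝ (b 2) (cyl b p : EuclideanSpace ℝ (Fin 3)) = p.2 := by
  have h0 := sqrt_one_sub_sq_pos hp.2
  rw [coe_cyl b hp, inner_smul_right, inner_frame_two, tanArcsin]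
  field_simp

end

/-! ### Cones over convex sets, and reflections of the sphere -/

lemma mem_openHemisphere_iff {u x : Sph2} :
    x ∈ openHemisphere u ↔ 0 < inner ℝ (u : E3) (x : E3) := by
  simp [openHemisphere, sdist, Real.arccos_lt_pi_div_two]

lemma mem_closedHemisphere_iff {u x : Sph2} :
    x ∈ closedHemisphere u ↔ 0 ≤ inner ℝ (u : E3) (x : E3) := by
  simp [closedHemisphere, sdist, Real.arccos_le_pi_div_two]

lemma norm_coe (u : Sph2) : ‖(u : E3)‖ = 1 := mem_sphere_zero_iff_norm.1 u.2

/-- The cone over a subset of the sphere, without its apex. -/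
def cone (K : Set Sph2) : Set E3 := {x | ∃ r : ℝ, 0 < r ∧ ∃ u ∈ K, x = r • (u : E3)}

lemma coe_mem_cone_iff {K : Set Sph2} {u : Sph2} : (u : E3) ∈ cone K ↔ u ∈ K := by
  constructor
  · rintro ⟨r, hr, v, hv, h⟩
    have h1 : r = 1 := by
      have := congrArg norm h
      rw [norm_smul, norm_coe, norm_coe, Real.norm_of_nonneg hr.le] at this
      linarith
    rw [h1, one_smul] at h
    rwa [Subtype.ext h]
  · intro h; exact ⟨1, one_pos, u, h, (one_smul _ _).symm⟩

lemma smul_mem_cone {K : Set Sph2} {x : E3} (hx : x ∈ cone K) {r : ℝ} (hr : 0 < r) :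
    r • x ∈ cone K := by
  obtain ⟨s, hs, u, hu, rfl⟩ := hx
  exact ⟨r * s, mul_pos hr hs, u, hu, smul_smul _ _ _⟩

lemma smul_mem_cone_iff {K : Set Sph2} {x : E3} {r : ℝ} (hr : 0 < r) :
    r • x ∈ cone K ↔ x ∈ cone K := by
  refine ⟨fun h => ?_, fun h => smul_mem_cone h hr⟩
  have := smul_mem_cone h (inv_pos.2 hr)
  rwa [inv_smul_smul₀ hr.ne'] at this

/-- The normalized sum lies on the segment between the two directions; the open hemisphere
containing K keeps the sum from vanishing. -/
lemma IsConvex.add_mem_cone {K : Set Sph2} (hK : IsConvex K) {x y : E3} (hx : x ∈ cone K)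
    (hy : y ∈ cone K) : x + y ∈ cone K := by
  obtain ⟨⟨w, hw⟩, hseg⟩ := hK
  obtain ⟨r, hr, u, hu, rfl⟩ := hx
  obtain ⟨s, hs, v, hv, rfl⟩ := hy
  have h1 := mem_openHemisphere_iff.1 (hw hu)
  have h2 := mem_openHemisphere_iff.1 (hw hv)
  have hne : r • (u : E3) + s • (v : E3) ≠ 0 := by
    intro h
    have := congrArg (fun z => inner ℝ (w : E3) z) h
    simp only [inner_add_right, inner_smul_right, inner_zero_right] at this
    nlinarith [mul_pos hr h1, mul_pos hs h2]
  have hn := norm_pos_iff.2 hne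
  refine ⟨_, hn, ⟨‖r • (u : E3) + s • (v : E3)‖⁻¹ • (r • (u : E3) + s • (v : E3)), ?_⟩, ?_, ?_⟩
  · rw [mem_sphere_zero_iff_norm, norm_smul, norm_inv, norm_norm, inv_mul_cancel₀ hn.ne']
  · refine hseg u hu v hv ⟨‖r • (u : E3) + s • (v : E3)‖⁻¹ * r, ‖r • (u : E3) + s • (v : E3)‖⁻¹ * s,
      by positivity, by positivity, ?_⟩
    simp only [smul_add, smul_smul]
  · simp only [smul_inv_smul₀ hn.ne']

lemma IsConvex.convex_cone {K : Set Sph2} (hK : IsConvex K) : Convex ℝ (cone K) := by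
  refine convex_iff_forall_pos.2 fun x hx y hy a b ha hb _ => ?_
  exact hK.add_mem_cone (smul_mem_cone hx ha) (smul_mem_cone hy hb)

lemma isOpen_cone {O : Set Sph2} (hO : IsOpen O) : IsOpen (cone O) := by
  have : cone O = Set.Ioi (0 : ℝ) • ((↑) '' O : Set E3) := by
    ext x
    simp only [cone, Set.mem_smul, Set.mem_ofPred_eq, Set.mem_image, Set.mem_Ioi]
    constructor
    · rintro ⟨r, hr, u, hu, rfl⟩; exact ⟨r, hr, _, ⟨u, hu, rfl⟩, rfl⟩
    · rintro ⟨r, hr, _, ⟨u, hu, rfl⟩, rfl⟩; exact ⟨r, hr, u, hu, rfl⟩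
  rw [this]
  exact isOpen_Ioi.smul_sphere one_ne_zero (by simp) hO

lemma cone_mono {A B : Set Sph2} (h : A ⊆ B) : cone A ⊆ cone B := by
  rintro x ⟨r, hr, u, hu, rfl⟩; exact ⟨r, hr, u, h hu, rfl⟩

/-- A linear isometry acts on the sphere. -/
noncomputable def sphMap (f : E3 ≃ₗᵢ[ℝ] E3) (u : Sph2) : Sph2 :=
  ⟨f u, by rw [mem_sphere_zero_iff_norm, f.norm_map, norm_coe]⟩

lemma continuous_sphMap (f : E3 ≃ₗᵢ[ℝ] E3) : Continuous (sphMap f) :=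
  Continuous.subtype_mk (f.continuous.comp continuous_subtype_val) _

lemma measurePreserving_sphMap (f : E3 ≃ₗᵢ[ℝ] E3) : MeasurePreserving (sphMap f) σ σ := by
  refine ⟨(continuous_sphMap f).measurable, ?_⟩
  ext A hA
  rw [Measure.map_apply (continuous_sphMap f).measurable hA, sigma_apply hA,
    sigma_apply ((continuous_sphMap f).measurable hA),
    ← (f.measurePreserving).measure_preimage_emb f.toHomeomorph.measurableEmbedding
      (Set.Ioo (0 : ℝ) 1 • ((↑) '' A : Set E3))]
  congr 2
  ext x
  simp only [Set.mem_smul, Set.mem_preimage, Set.mem_image]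
  constructor
  · rintro ⟨r, hr, _, ⟨u, hu, rfl⟩, rfl⟩
    exact ⟨r, hr, _, ⟨sphMap f u, hu, rfl⟩, by simp [sphMap]⟩
  · rintro ⟨r, hr, _, ⟨u, hu, rfl⟩, h⟩
    refine ⟨r, hr, _, ⟨sphMap f.symm u, ?_, rfl⟩, ?_⟩
    · have : sphMap f (sphMap f.symm u) = u := by ext1; simp [sphMap]
      rwa [this]
    · apply f.injective; simp [sphMap, h]

/-- The reflection in the plane orthogonal to a point of the sphere. -/
noncomputable def reflect (x : Sph2) : E3 ≃ₗᵢ[ℝ] E3 := (ℝ ∙ (x : E3))ᗮ.reflection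

lemma reflect_apply (x : Sph2) (v : E3) :
    reflect x v = v - (2 * inner ℝ (x : E3) v) • (x : E3) := by
  rw [reflect, Submodule.reflection_orthogonal_apply, Submodule.reflection_singleton_apply]
  simp [two_smul, two_mul, add_smul]

lemma inner_reflect (x : Sph2) (v : E3) :
    inner ℝ (x : E3) (reflect x v) = - inner ℝ (x : E3) v := by
  rw [reflect_apply, inner_sub_right, inner_smul_right, real_inner_self_eq_norm_sq, norm_coe]
  ring

lemma reflect_reflect (x : Sph2) (v : E3) : reflect x (reflect x v) = v :=
  Submodule.reflection_reflection _ _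

/-! ### Position of the centroid relative to the disk -/

lemma integrable_of_continuous {F : Type*} [NormedAddCommGroup F] {f : Sph2 → F}
    (hf : Continuous f) : Integrable f σ :=
  hf.integrable_of_hasCompactSupport (HasCompactSupport.of_compactSpace f)

lemma inner_moment (v : E3) (A : Set Sph2) :
    inner ℝ v (moment A) = ∫ u in A, inner ℝ v (u : E3) ∂σ :=
  (integral_inner (integrable_of_continuous continuous_subtype_val).integrableOn v).symm

/-- The reflected point is u − 2⟨x, u⟩x, a combination of u and x with nonnegative coefficients. -/
lemma reflect_mem_of_inner_neg {K : Set Sph2} (hK : IsConvex K) {x u : Sph2} (hx : x ∈ K)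
    (hu : u ∈ K) (h : inner ℝ (x : E3) (u : E3) < 0) : sphMap (reflect x) u ∈ K := by
  refine hK.2 u hu x hx ⟨1, -(2 * inner ℝ (x : E3) (u : E3)), zero_le_one, by linarith, ?_⟩
  change reflect x u = _
  rw [reflect_apply, one_smul, neg_smul, sub_eq_add_neg]

lemma reflect_self (x : Sph2) : reflect x (x : E3) = -(x : E3) := by
  rw [reflect_apply, real_inner_self_eq_norm_sq, norm_coe]; module

lemma neg_notMem_of_mem {K : Set Sph2} (hK : IsConvex K) {x y : Sph2} (hx : x ∈ K)
    (hy : (y : E3) = -(x : E3)) : y ∉ K := by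
  obtain ⟨⟨w, hw⟩, -⟩ := hK
  intro h
  have h1 := mem_openHemisphere_iff.1 (hw hx)
  have h2 := mem_openHemisphere_iff.1 (hw h)
  rw [hy, inner_neg_right] at h2
  linarith

/-- Every neighbourhood of a point of a convex disk meets the disk in positive measure, through
a relatively open set. -/
lemma IsConvexDisk.sigma_inter_pos {K : Set Sph2} (hK : IsConvexDisk K) {x : Sph2} (hx : x ∈ K)
    {N : Set Sph2} (hN : IsOpen N) (hxN : x ∈ N) : 0 < σ (K ∩ N) := by
  obtain ⟨o, ho⟩ := hK.nonempty_interior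
  obtain ⟨⟨w, hw⟩, -⟩ := id hK.isConvex
  have hwx := mem_openHemisphere_iff.1 (hw hx)
  have hwo := mem_openHemisphere_iff.1 (hw (interior_subset ho))
  have hne : ∀ d : ℝ, 0 ≤ d → (x : E3) + d • (o : E3) ≠ 0 := by
    intro d hd h
    have := congrArg (fun z => inner ℝ (w : E3) z) h
    simp only [inner_add_right, inner_smul_right, inner_zero_right] at this
    nlinarith [mul_nonneg hd hwo.le]
  obtain ⟨N', hN', rfl⟩ := isOpen_induced_iff.1 hN
  have hcont : ContinuousAt (fun d : ℝ => ‖(x : E3) + d • (o : E3)‖⁻¹ • ((x : E3) + d • (o : E3))) 0 := by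
    have hcc : Continuous fun d : ℝ => (x : E3) + d • (o : E3) := by fun_prop
    exact (hcc.norm.continuousAt.inv₀ (norm_ne_zero_iff.2 (hne 0 le_rfl))).smul hcc.continuousAt
  have hev : ∀ᶠ d : ℝ in nhds 0,
      ‖(x : E3) + d • (o : E3)‖⁻¹ • ((x : E3) + d • (o : E3)) ∈ N' := by
    refine hcont.eventually (hN'.mem_nhds ?_)
    simpa [norm_coe] using hxN
  obtain ⟨d, hd, hd0⟩ := ((hev.filter_mono nhdsWithin_le_nhds).and
    (self_mem_nhdsWithin (a := (0 : ℝ)) (s := Set.Ioi 0))).exists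
  have hd0' : 0 < d := hd0
  set s := ‖(x : E3) + d • (o : E3)‖⁻¹ with hs
  have hn := norm_pos_iff.2 (hne d hd0'.le)
  have hspos : 0 < s := inv_pos.2 hn
  -- Each point of V is `s • x` plus a vector of the cone over the interior of K, so convexity puts
  -- V inside K.
  set V : Set Sph2 := {u | (u : E3) - s • (x : E3) ∈ cone (interior K)} ∩ Subtype.val ⁻¹' N'
  have hVo : IsOpen V :=
    ((isOpen_cone isOpen_interior).preimage (by fun_prop)).inter hN
  have hVne : V.Nonempty := by
    refine ⟨⟨s • ((x : E3) + d • (o : E3)), ?_⟩, ?_, hd⟩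
    · rw [mem_sphere_zero_iff_norm, norm_smul, Real.norm_of_nonneg hspos.le, hs,
        inv_mul_cancel₀ hn.ne']
    · refine ⟨s * d, by positivity, o, ho, ?_⟩
      simp only [smul_add, smul_smul]; abel
  refine lt_of_lt_of_le (hVo.measure_pos σ hVne) (measure_mono fun u hu => ⟨?_, hu.2⟩)
  rw [← coe_mem_cone_iff]
  have h1 := hK.isConvex.add_mem_cone (cone_mono interior_subset hu.1)
    (smul_mem_cone (coe_mem_cone_iff.2 hx) hspos)
  simpa using h1

lemma IsConvexDisk.measurableSet {K : Set Sph2} (hK : IsConvexDisk K) : MeasurableSet K :=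
  hK.isCompact.isClosed.measurableSet

/-- Reflection in the plane orthogonal to x carries the part of K with ⟨x, u⟩ < 0 into the rest of K
and so cancels its contribution. Something of positive measure remains near x, because −x is not in
K. -/
lemma IsConvexDisk.inner_moment_pos {K : Set Sph2} (hK : IsConvexDisk K) {x : Sph2} (hx : x ∈ K) :
    0 < inner ℝ (x : E3) (moment K) := by
  rw [inner_moment]
  set h : Sph2 → ℝ := fun u => inner ℝ (x : E3) (u : E3) with hh
  have hc : Continuous h := by fun_prop
  have hint : Integrable h σ := integrable_of_continuous hc
  have hKm := hK.measurableSet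
  set R := sphMap (reflect x) with hR
  have hRc : Continuous R := continuous_sphMap _
  have hRR : ∀ u, R (R u) = u := fun u => Subtype.ext (reflect_reflect x u)
  have hhR : ∀ u, h (R u) = - h u := fun u => inner_reflect x u
  have hKn : MeasurableSet (K ∩ {u | h u < 0}) := hKm.inter (measurableSet_lt hc.measurable measurable_const)
  have hKp : MeasurableSet (K ∩ {u | ¬ h u < 0}) :=
    hKm.inter (measurableSet_lt hc.measurable measurable_const).compl
  have e1 : ∫ u in K, h u ∂σ =
      ∫ u in K ∩ {u | h u < 0}, h u ∂σ + ∫ u in K ∩ {u | ¬ h u < 0}, h u ∂σ :=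
    (integral_inter_add_sdiff (measurableSet_lt hc.measurable measurable_const) hint.integrableOn).symm
  have e2 : ∫ u in K ∩ {u | h u < 0}, h u ∂σ = - ∫ u in R ⁻¹' (K ∩ {u | h u < 0}), h u ∂σ := by
    have hemb : MeasurableEmbedding R :=
      hRc.measurableEmbedding fun u v huv => by rw [← hRR u, huv, hRR]
    rw [← (measurePreserving_sphMap (reflect x)).setIntegral_preimage_emb hemb, ← integral_neg]
    simp_rw [← hR, hhR]
  have hsub : R ⁻¹' (K ∩ {u | h u < 0}) ⊆ K ∩ {u | ¬ h u < 0} := by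
    rintro u ⟨hu1, hu2⟩
    refine ⟨hRR u ▸ reflect_mem_of_inner_neg hK.isConvex hx hu1 hu2, ?_⟩
    have h3 : h (R u) < 0 := hu2
    rw [hhR] at h3
    simp only [Set.mem_ofPred_eq]; linarith
  have e3 := setIntegral_sdiff (f := h) (μ := σ) (hRc.measurable hKn) hint.integrableOn hsub
  rw [e1, e2, neg_add_eq_sub, ← e3]
  rw [setIntegral_pos_iff_support_of_nonneg_ae _ hint.integrableOn]
  · set N : Set Sph2 := {u | 0 < h u} ∩ R ⁻¹' Kᶜ
    have hN : IsOpen N := (isOpen_lt continuous_const hc).inter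
      (hK.isCompact.isClosed.isOpen_compl.preimage hRc)
    have hxN : x ∈ N := by
      refine ⟨?_, neg_notMem_of_mem hK.isConvex hx (reflect_self x)⟩
      simp [hh]
    refine lt_of_lt_of_le (hK.sigma_inter_pos hx hN hxN) (measure_mono ?_)
    rintro u ⟨hu, hu1, hu2⟩
    have hu1' : 0 < h u := hu1
    refine ⟨hu1'.ne', ⟨hu, not_lt.2 hu1'.le⟩, fun h3 => hu2 h3.1⟩
  · filter_upwards [ae_restrict_mem (hKp.diff (hRc.measurable hKn))] with u hu
    exact not_lt.1 hu.1.2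

lemma IsCentroid.moment_eq {A : Set Sph2} {c : Sph2} (hc : IsCentroid A c) :
    moment A = ‖moment A‖ • (c : E3) := by
  rw [hc.eq, smul_inv_smul₀ (norm_ne_zero_iff.2 hc.moment_ne_zero)]

lemma IsCentroid.norm_moment_pos {A : Set Sph2} {c : Sph2} (hc : IsCentroid A c) :
    0 < ‖moment A‖ := norm_pos_iff.2 hc.moment_ne_zero

lemma IsConvexDisk.inner_centroid_pos {K : Set Sph2} (hK : IsConvexDisk K) {c : Sph2}
    (hc : IsCentroid K c) {x : Sph2} (hx : x ∈ K) : 0 < inner ℝ (c : E3) (x : E3) := by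
  have h := hK.inner_moment_pos hx
  rw [hc.moment_eq, inner_smul_right, real_inner_comm] at h
  exact (mul_pos_iff_of_pos_left hc.norm_moment_pos).1 h

/-- Otherwise a functional f separates c from the interior of the cone. Scaling forces f ≤ 0 on the
cone over the interior of K and f c ≥ 0; openness and closure then give f < 0 on the interior of K
and f ≤ 0 on K. Hence f is negative at the moment, which is a positive multiple of c. -/
lemma IsConvexDisk.centroid_mem_interior_cone {K : Set Sph2} (hK : IsConvexDisk K) {c : Sph2}
    (hc : IsCentroid K c) : (c : E3) ∈ interior (cone K) := by
  by_contra hcon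
  have hO : cone (interior K) ⊆ interior (cone K) :=
    interior_maximal (cone_mono interior_subset) (isOpen_cone isOpen_interior)
  have hconv := hK.isConvex.convex_cone
  obtain ⟨f, hf⟩ := geometric_hahn_banach_open_point hconv.interior isOpen_interior hcon
  obtain ⟨o, ho⟩ := hK.nonempty_interior
  have hoU : (o : E3) ∈ interior (cone K) := hO (coe_mem_cone_iff.2 ho)
  have hscale : ∀ a ∈ cone (interior K), ∀ r : ℝ, 0 < r → r * f a < f c := by
    intro a ha r hr
    have := hf _ (hO (smul_mem_cone ha hr))
    simpa using this
  have hle : ∀ a ∈ cone (interior K), f a ≤ 0 := by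
    intro a ha
    by_contra hpos
    push Not at hpos
    have h1 := hscale a ha ((|f c| + 1) / f a) (by positivity)
    rw [div_mul_cancel₀ _ hpos.ne'] at h1
    linarith [le_abs_self (f c)]
  have hfc : 0 ≤ f c := by
    by_contra hneg
    push Not at hneg
    have ho' : (o : E3) ∈ cone (interior K) := coe_mem_cone_iff.2 ho
    have h1 := hscale o ho' (-(f c) / (2 * (|f o| + 1))) (div_pos (by linarith) (by positivity))
    have h2 : -|f o| ≤ f o := neg_abs_le _
    have h3 : 0 ≤ -(f c) / (2 * (|f o| + 1)) := (div_pos (by linarith) (by positivity)).le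
    have h4 : -(f c) / (2 * (|f o| + 1)) * (|f o| + 1) = -(f c) / 2 := by
      have : |f o| + 1 ≠ 0 := by positivity
      field_simp
    nlinarith
  have hlt : ∀ a ∈ cone (interior K), f a < 0 := by
    intro a ha
    refine lt_of_le_of_ne (hle a ha) fun h0 => ?_
    have hfc' : 0 < f c := by
      have := hf _ (hO ha); rwa [h0] at this
    have hev : ∀ᶠ t : ℝ in nhds 0, a + t • (c : E3) ∈ cone (interior K) := by
      have hct : ContinuousAt (fun t : ℝ => a + t • (c : E3)) 0 := by fun_prop
      exact hct.eventually ((isOpen_cone isOpen_interior).mem_nhds (by simpa using ha))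
    obtain ⟨t, ht, ht0⟩ := ((hev.filter_mono nhdsWithin_le_nhds).and
      (self_mem_nhdsWithin (a := (0 : ℝ)) (s := Set.Ioi 0))).exists
    have ht0' : 0 < t := ht0
    have h5 := hle _ ht
    simp only [map_add, map_smul, h0, zero_add, smul_eq_mul] at h5
    nlinarith
  have hclos : ∀ u ∈ K, f (u : E3) ≤ 0 := by
    intro u hu
    by_contra hpos
    push Not at hpos
    have h6 : (u : E3) ∈ closure (interior (cone K)) := by
      rw [hconv.closure_interior_eq_closure_of_nonempty_interior ⟨_, hoU⟩]
      exact subset_closure (coe_mem_cone_iff.2 hu)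
    obtain ⟨y, hy1, hy2⟩ := mem_closure_iff.1 h6 {y | 0 < f y}
      (isOpen_lt continuous_const (by fun_prop)) hpos
    have hyo : ∀ r : ℝ, 0 < r → r * f y < f c := by
      intro r hr
      have hmem : r • y ∈ interior (cone K) := by
        have hsub : r • interior (cone K) ⊆ interior (cone K) := by
          refine interior_maximal ?_ (isOpen_interior.smul₀ hr.ne')
          rintro _ ⟨z, hz, rfl⟩
          exact smul_mem_cone (interior_subset hz) hr
        exact hsub (Set.smul_mem_smul_set hy2)
      simpa using hf _ hmem
    have hy1' : 0 < f y := hy1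
    have h1 := hyo ((|f c| + 1) / f y) (by positivity)
    rw [div_mul_cancel₀ _ hy1'.ne'] at h1
    linarith [le_abs_self (f c)]
  have hfi : Continuous fun u : Sph2 => -f (u : E3) := by fun_prop
  have hpos : 0 < ∫ u in K, -f (u : E3) ∂σ := by
    rw [setIntegral_pos_iff_support_of_nonneg_ae _ (integrable_of_continuous hfi).integrableOn]
    · refine lt_of_lt_of_le (isOpen_interior.measure_pos σ ⟨o, ho⟩) (measure_mono fun u hu => ?_)
      exact ⟨(neg_pos.2 (hlt _ (coe_mem_cone_iff.2 hu))).ne', interior_subset hu⟩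
    · filter_upwards [ae_restrict_mem hK.measurableSet] with u hu
      exact neg_nonneg.2 (hclos u hu)
  rw [integral_neg, ContinuousLinearMap.integral_comp_comm f
    (integrable_of_continuous continuous_subtype_val).integrableOn] at hpos
  change 0 < -f (moment K) at hpos
  rw [hc.moment_eq, map_smul, smul_eq_mul] at hpos
  nlinarith [hc.norm_moment_pos]

/-! ### Trigonometric inequalities along great circles -/

/-- Longitude, relative to the intersection with the equator, of the great circle through a point of
relative longitude `x`, at the level where the tangent of the latitude is scaled by `r`. -/
noncomputable def lonScale (r x : ℝ) : ℝ := Real.arcsin (r * Real.sin x)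

lemma abs_mul_sin_lt_one {r : ℝ} (h0 : 0 ≤ r) (h1 : r < 1) (x : ℝ) : |r * Real.sin x| < 1 := by
  rw [abs_mul, abs_of_nonneg h0]
  nlinarith [Real.abs_sin_le_one x, abs_nonneg (Real.sin x)]

/-- The derivative r cos x / √(1 − r² sin² x) is at most r in absolute value, since r ≤ 1 gives 1 −
r² sin² x ≥ cos² x. -/
lemma lipschitz_lonScale {r : ℝ} (h0 : 0 ≤ r) (h1 : r < 1) (x y : ℝ) :
    |lonScale r x - lonScale r y| ≤ r * |x - y| := by
  have hd : ∀ x, HasDerivAt (lonScale r) (1 / √(1 - (r * Real.sin x) ^ 2) * (r * Real.cos x)) x := by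
    intro x
    have h := abs_lt.1 (abs_mul_sin_lt_one h0 h1 x)
    exact (Real.hasDerivAt_arcsin h.1.ne' h.2.ne).comp x ((Real.hasDerivAt_sin x).const_mul r)
  have hb : ∀ x ∈ Set.univ, ‖1 / √(1 - (r * Real.sin x) ^ 2) * (r * Real.cos x)‖ ≤ r := by
    intro x _
    have h := abs_lt.1 (abs_mul_sin_lt_one h0 h1 x)
    have hp : 0 < 1 - (r * Real.sin x) ^ 2 := by nlinarith
    have hc : |Real.cos x| ≤ √(1 - (r * Real.sin x) ^ 2) := by
      refine Real.abs_le_sqrt ?_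
      have h2 : r ^ 2 ≤ 1 := by nlinarith
      nlinarith [Real.sin_sq_add_cos_sq x, mul_le_mul_of_nonneg_right h2 (sq_nonneg (Real.sin x))]
    have hs := Real.sqrt_pos.2 hp
    rw [Real.norm_eq_abs, abs_mul, abs_mul, abs_of_nonneg h0, abs_of_pos (by positivity)]
    rw [one_div, inv_mul_le_iff₀ hs, mul_comm]
    exact mul_le_mul_of_nonneg_right hc h0
  have := convex_univ.norm_image_sub_le_of_norm_hasDerivWithin_le
    (fun x _ => (hd x).hasDerivWithinAt) hb (Set.mem_univ y) (Set.mem_univ x)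
  simpa using this

lemma lonScale_mono {r x y : ℝ} (h0 : 0 ≤ r) (hy : -(Real.pi / 2) ≤ y) (hyx : y ≤ x)
    (hx : x ≤ Real.pi / 2) : lonScale r y ≤ lonScale r x :=
  Real.monotone_arcsin (mul_le_mul_of_nonneg_left
    (Real.strictMonoOn_sin.monotoneOn ⟨hy, hyx.trans hx⟩ ⟨hy.trans hyx, hx⟩ hyx) h0)

lemma lonScale_sub_ge {r x y : ℝ} (h0 : 0 ≤ r) (h1 : r < 1) (hx : x ≤ Real.pi / 2)
    (hy : -(Real.pi / 2) ≤ y) : r * min 0 (x - y) ≤ lonScale r x - lonScale r y := by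
  rcases le_total y x with h | h
  · rw [min_eq_left (by linarith), mul_zero, sub_nonneg]
    exact lonScale_mono h0 hy h hx
  · rw [min_eq_right (by linarith)]
    have := (abs_le.1 (lipschitz_lonScale h0 h1 x y)).1
    rw [abs_of_nonpos (by linarith : x - y ≤ 0)] at this
    linarith

/-- This is the sign condition for the derivative in `lonScale_tangent`, with e = cos² t. If e + r −
1 > 0, the squares of the two sides differ by (r − 1)²(1 − e)((e + r − 1)(r + 1) + er) ≥ 0. -/
lemma tangent_poly {r e : ℝ} (h0 : 0 ≤ r) (he0 : 0 < e) (he1 : e ≤ 1)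
    (hpos : 0 < 1 - r ^ 2 * (1 - e)) :
    (e + (r - 1)) * √(1 - r ^ 2 * (1 - e)) ≤ r * √e * e := by
  rcases le_or_gt (e + (r - 1)) 0 with h | h
  · have h1 : (e + (r - 1)) * √(1 - r ^ 2 * (1 - e)) ≤ 0 :=
      mul_nonpos_of_nonpos_of_nonneg h (Real.sqrt_nonneg _)
    have h2 : 0 ≤ r * √e * e := by positivity
    linarith
  · refine (abs_le_of_sq_le_sq' ?_ (by positivity)).2
    rw [mul_pow, mul_pow, mul_pow, Real.sq_sqrt hpos.le, Real.sq_sqrt he0.le]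
    have h3 : 0 ≤ (r - 1) ^ 2 * (1 - e) * ((e + (r - 1)) * (r + 1) + e * r) := by
      have : 0 ≤ 1 - e := by linarith
      positivity
    nlinarith

/-- Tangent line inequality for the width of a wedge bounded by two great circles. -/
lemma lonScale_tangent {r x y : ℝ} (h0 : 0 ≤ r) (hy : -(Real.pi / 2) < y) (hyx : y ≤ x)
    (hx : x < Real.pi / 2) (hry : -1 ≤ r * Real.sin y) (hrx : r * Real.sin x ≤ 1) :
    x - y + (Real.tan x - Real.tan y) * (r - 1) ≤ lonScale r x - lonScale r y := by
  have hmem : ∀ t ∈ Set.Icc y x, t ∈ Set.Ioo (-(Real.pi / 2)) (Real.pi / 2) := fun t ht =>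
    ⟨hy.trans_le ht.1, ht.2.trans_lt hx⟩
  have hsin : ∀ t ∈ Set.Ioo y x, -1 < r * Real.sin t ∧ r * Real.sin t < 1 := by
    intro t ht
    have hs1 : Real.sin y < Real.sin t := Real.strictMonoOn_sin
      ⟨hy.le, by linarith⟩ ⟨(hy.trans ht.1).le, by linarith [ht.2]⟩ ht.1
    have hs2 : Real.sin t < Real.sin x := Real.strictMonoOn_sin
      ⟨(hy.trans ht.1).le, by linarith [ht.2]⟩ ⟨by linarith, hx.le⟩ ht.2
    rcases h0.eq_or_lt with rfl | h
    · simp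
    · constructor <;> nlinarith
  have hder : ∀ t ∈ interior (Set.Icc y x),
      HasDerivAt (fun t => lonScale r t - t - (r - 1) * Real.tan t)
        (1 / √(1 - (r * Real.sin t) ^ 2) * (r * Real.cos t) - 1 -
          (r - 1) * (1 / Real.cos t ^ 2)) t := by
    intro t ht
    rw [interior_Icc] at ht
    have hs := hsin t ht
    have htm := hmem t ⟨ht.1.le, ht.2.le⟩
    exact ((((Real.hasDerivAt_arcsin hs.1.ne' hs.2.ne).comp t
      ((Real.hasDerivAt_sin t).const_mul r))).sub (hasDerivAt_id t)).sub
        ((Real.hasDerivAt_tan_of_mem_Ioo htm).const_mul _)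
  -- The map r ↦ arcsin(r sin t) has value t and slope tan t at r = 1. Comparing its error from this
  -- tangent at x and at y amounts to monotonicity of the error in t.
  have hmono : MonotoneOn (fun t => lonScale r t - t - (r - 1) * Real.tan t) (Set.Icc y x) := by
    refine monotoneOn_of_deriv_nonneg (convex_Icc _ _) ?_ ?_ ?_
    · refine ContinuousOn.sub (ContinuousOn.sub ?_ continuousOn_id) (continuousOn_const.mul ?_)
      · exact (Real.continuous_arcsin.comp (continuous_const.mul Real.continuous_sin)).continuousOn
      · exact Real.continuousOn_tan_Ioo.mono hmem
    · exact fun t ht => (hder t ht).differentiableAt.differentiableWithinAt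
    · intro t ht
      rw [(hder t ht).deriv]
      rw [interior_Icc] at ht
      have htm := hmem t ⟨ht.1.le, ht.2.le⟩
      have hc := Real.cos_pos_of_mem_Ioo htm
      have hs := hsin t ht
      have hD : 0 < 1 - (r * Real.sin t) ^ 2 := by nlinarith
      have hsc := Real.sin_sq_add_cos_sq t
      have hD' : 1 - (r * Real.sin t) ^ 2 = 1 - r ^ 2 * (1 - Real.cos t ^ 2) := by
        rw [← hsc]; ring
      have htp := tangent_poly (e := Real.cos t ^ 2) h0 (by positivity)
        (by nlinarith [sq_nonneg (Real.sin t)]) (hD' ▸ hD)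
      rw [← hD', Real.sqrt_sq hc.le] at htp
      have hsq := Real.sqrt_pos.2 hD
      have h5 : 1 + (r - 1) * (1 / Real.cos t ^ 2) ≤
          1 / √(1 - (r * Real.sin t) ^ 2) * (r * Real.cos t) := by
        rw [one_div_mul_eq_div, le_div_iff₀ hsq]
        have h6 : 1 + (r - 1) * (1 / Real.cos t ^ 2) =
            (Real.cos t ^ 2 + (r - 1)) / Real.cos t ^ 2 := by field_simp
        rw [h6, div_mul_eq_mul_div, div_le_iff₀ (by positivity)]
        exact htp
      linarith
  have := hmono ⟨le_rfl, hyx⟩ ⟨hyx, le_rfl⟩ hyx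
  simp only at this
  linarith

/-- A tangent line inequality at t = z: the logarithmic derivative of `tanArcsin` at z is 1/(z(1 −
z²)). -/
lemma tanArcsin_tangent {z t : ℝ} (hz : z ∈ Set.Ioo (0 : ℝ) 1) (ht : t ∈ Set.Ioo (0 : ℝ) 1) :
    (t - z) / (z * (1 - z ^ 2)) ≤ tanArcsin t / tanArcsin z - 1 := by
  obtain ⟨hz0, hz1⟩ := hz
  obtain ⟨ht0, ht1⟩ := ht
  have hz' : z ∈ Set.Ioo (-1 : ℝ) 1 := ⟨by linarith, hz1⟩
  have ht' : t ∈ Set.Ioo (-1 : ℝ) 1 := ⟨by linarith, ht1⟩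
  have ha := sqrt_one_sub_sq_pos hz'
  have hb := sqrt_one_sub_sq_pos ht'
  have ha2 := sq_sqrt_one_sub_sq hz'
  have hb2 := sq_sqrt_one_sub_sq ht'
  set a := √(1 - z ^ 2)
  set b := √(1 - t ^ 2)
  have key : (t - z ^ 3) * b ≤ t * a ^ 3 := by
    rcases le_or_gt (t - z ^ 3) 0 with h | h
    · have h1 := mul_nonpos_of_nonpos_of_nonneg h hb.le
      have h2 : 0 ≤ t * a ^ 3 := by positivity
      linarith
    · refine (abs_le_of_sq_le_sq' ?_ (by positivity)).2
      have e1 : (t * a ^ 3) ^ 2 = t ^ 2 * (1 - z ^ 2) ^ 3 := by rw [← ha2]; ring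
      rw [e1, mul_pow, hb2]
      -- The difference of the squared sides is (t − z)² times this polynomial.
      have h3 : 0 ≤ t ^ 2 + 2 * z * (1 - z ^ 2) * t - z ^ 4 := by
        have h4 : z ^ 3 * z ^ 3 ≤ t ^ 2 := by nlinarith [pow_pos hz0 3]
        have h5 : z * (1 - z ^ 2) * z ^ 3 ≤ z * (1 - z ^ 2) * t :=
          mul_le_mul_of_nonneg_left (by linarith) (by nlinarith)
        nlinarith [pow_pos hz0 4, mul_pos (pow_pos hz0 4) (by nlinarith : 0 < 1 - z ^ 2)]
      nlinarith [mul_nonneg (sq_nonneg (t - z)) h3]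
  have e2 : tanArcsin t / tanArcsin z = t * a / (b * z) := by
    simp only [tanArcsin]; change t / b / (z / a) = _; field_simp
  rw [e2, ← ha2, div_le_iff₀ (by positivity)]
  have e3 : (t * a / (b * z) - 1) * (z * a ^ 2) = (t * a ^ 3) / b - z * a ^ 2 := by field_simp
  rw [e3, le_sub_iff_add_le, le_div_iff₀ hb, ha2]
  linarith [key, show (t - z + z * (1 - z ^ 2)) * b = (t - z ^ 3) * b by ring]

/-- Strict because √(1 − x²) strictly decreases. This strictness separates the sphere from the
plane, where triangles attain 5/4. -/
lemma tanArcsin_ratio_lt {z t : ℝ} (ht : 0 < t) (htz : t < z) (hz : z < 1) :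
    tanArcsin t / tanArcsin z < t / z := by
  have hz' : z ∈ Set.Ioo (-1 : ℝ) 1 := ⟨by linarith, hz⟩
  have ht' : t ∈ Set.Ioo (-1 : ℝ) 1 := ⟨by linarith, htz.trans hz⟩
  have ha := sqrt_one_sub_sq_pos hz'
  have hb := sqrt_one_sub_sq_pos ht'
  have hab : √(1 - z ^ 2) < √(1 - t ^ 2) :=
    Real.sqrt_lt_sqrt (by nlinarith) (by nlinarith)
  have hz0 : 0 < z := ht.trans htz
  simp only [tanArcsin]
  rw [div_div_div_eq, div_lt_div_iff₀ (by positivity) hz0]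
  nlinarith [mul_pos ht hz0]

/-! ### Comparison of one-dimensional profiles -/

lemma integrableOn_indicator_Ioc {a b : ℝ} {p : ℝ → ℝ} (hp : Continuous p) :
    IntegrableOn ((Set.Ioc a b).indicator p) (Set.Ioi 0) :=
  ((hp.integrableOn_Icc.mono_set Set.Ioc_subset_Icc_self).integrable_indicator
    measurableSet_Ioc).integrableOn

lemma setIntegral_indicator_Ioc {a b : ℝ} (ha : 0 ≤ a) (hab : a ≤ b) (p : ℝ → ℝ) :
    ∫ x in Set.Ioi 0, (Set.Ioc a b).indicator p x = ∫ x in a..b, p x := by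
  rw [setIntegral_indicator measurableSet_Ioc, intervalIntegral.integral_of_le hab]
  congr 2
  exact Set.inter_eq_right.2 fun x hx => ha.trans_lt hx.1

lemma integral_sub_sub_mul_sub {F F' G G' : ℝ → ℝ} {μ : Measure ℝ} (hF : Integrable F μ)
    (hF' : Integrable F' μ) (hG : Integrable G μ) (hG' : Integrable G' μ) (c : ℝ) :
    ∫ t, F t - F' t - c * (G t - G' t) ∂μ =
      (∫ t, F t ∂μ) - (∫ t, F' t ∂μ) - c * ((∫ t, G t ∂μ) - ∫ t, G' t ∂μ) := by
  rw [integral_sub (f := fun t => F t - F' t) (g := fun t => c * (G t - G' t)) (hF.sub hF')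
    ((hG.sub hG').const_mul c), integral_const_mul, integral_sub hF hF', integral_sub hG hG']

/-- A profile that crosses the linear profile of equal area and equal base once, from above to below,
has smaller moment. -/
lemma moment_lt_of_profile {f : ℝ → ℝ} {N : Set ℝ} {w : ℝ} (hw : 0 < w)
    (hf0 : ∀ x, 0 ≤ f x) (hfi : IntegrableOn f (Set.Ioi 0))
    (hfi' : IntegrableOn (fun x => x * f x) (Set.Ioi 0))
    (hNb : BddAbove N) (hfN : ∀ x, 0 < x → x ∉ N → f x = 0)
    (hA : 0 < ∫ x in Set.Ioi 0, f x)
    (h1 : ∀ s ∈ N, ∀ t, 0 < t → t < s → ∃ r, 0 ≤ r ∧ r < t / s ∧ w + r * min 0 (f s - w) ≤ f t)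
    {H : ℝ} (hH : H = 2 * (∫ x in Set.Ioi 0, f x) / w) :
    ∫ x in Set.Ioi 0, x * f x < w * H ^ 2 / 6 := by
  have hH0 : 0 < H := by rw [hH]; positivity
  set p : ℝ → ℝ := fun x => w * (1 - x / H) with hp
  set l : ℝ → ℝ := (Set.Ioc 0 H).indicator p with hl
  have hli : IntegrableOn l (Set.Ioi 0) := integrableOn_indicator_Ioc (by fun_prop)
  have hxl : (fun x => x * l x) = (Set.Ioc 0 H).indicator (fun x => x * p x) := by
    ext x; by_cases hx : x ∈ Set.Ioc 0 H <;> simp [hl, hx]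
  have hli' : IntegrableOn (fun x => x * l x) (Set.Ioi 0) := by
    rw [hxl]; exact integrableOn_indicator_Ioc (by fun_prop)
  have hl1 : ∫ x in Set.Ioi 0, l x = w * H / 2 := by
    rw [hl, setIntegral_indicator_Ioc le_rfl hH0.le]
    simp only [hp]
    rw [intervalIntegral.integral_const_mul, intervalIntegral.integral_sub (by simp)
      (Continuous.intervalIntegrable (by fun_prop) _ _), intervalIntegral.integral_div]
    simp only [intervalIntegral.integral_const, integral_id, smul_eq_mul]
    field_simp; ring
  have hl2 : ∫ x in Set.Ioi 0, x * l x = w * H ^ 2 / 6 := by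
    rw [hxl, setIntegral_indicator_Ioc le_rfl hH0.le]
    have : ∀ x, x * p x = w * x - w / H * x ^ 2 := fun x => by simp only [hp]; ring
    simp_rw [this]
    rw [intervalIntegral.integral_sub (Continuous.intervalIntegrable (by fun_prop) _ _)
      (Continuous.intervalIntegrable (by fun_prop) _ _), intervalIntegral.integral_const_mul,
      intervalIntegral.integral_const_mul, integral_pow, integral_id]
    field_simp; ring
  -- The crossing point c is the supremum of the points where f is on or above the line; 0 is
  -- inserted to make the set nonempty.
  set N' : Set ℝ := {s ∈ N | p s ≤ f s}
  set c := sSup (insert 0 N')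
  have hbdd : BddAbove (insert 0 N') := (hNb.mono fun s hs => hs.1).insert 0
  -- At some s > t the drop of f below w is at most ws/H. By `h1` the drop at t is at most r times
  -- that, and r < t/s makes it less than wt/H.
  have hlow : ∀ t, 0 < t → t < c → p t < f t := by
    intro t ht htc
    obtain ⟨s, hs, hts⟩ := exists_lt_of_lt_csSup (Set.insert_nonempty _ _) htc
    rcases hs with rfl | ⟨hsN, hs⟩
    · linarith
    obtain ⟨r, hr0, hr, hle⟩ := h1 s hsN t ht hts
    have hs0 : 0 < s := ht.trans hts
    have hm : -(w * s / H) ≤ min 0 (f s - w) := by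
      refine le_min (by simp; positivity) ?_
      simp only [hp] at hs; linarith [show w * (1 - s / H) = w - w * s / H by ring]
    have e1 : r * (w * s / H) < t / s * (w * s / H) := mul_lt_mul_of_pos_right hr (by positivity)
    have e2 : t / s * (w * s / H) = w * t / H := by field_simp
    have e3 : p t = w - w * t / H := by simp only [hp]; ring
    nlinarith [mul_le_mul_of_nonneg_left hm hr0]
  have hhigh : ∀ t, 0 < t → c < t → f t = 0 ∨ f t < p t := by
    intro t ht hct
    by_cases htN : t ∈ N
    · right
      by_contra hcon
      exact absurd (le_csSup hbdd (Set.mem_insert_of_mem 0 ⟨htN, not_lt.1 hcon⟩)) (not_le.2 hct)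
    · exact Or.inl (hfN t ht htN)
  have hin : ∀ t, 0 < t → t ≤ H → l t = p t := fun t h0 h1 =>
    Set.indicator_of_mem (show t ∈ Set.Ioc 0 H from ⟨h0, h1⟩) _
  have hout : ∀ t, H < t → l t = 0 := fun t h0 =>
    Set.indicator_of_notMem (fun h => absurd h.2 (not_le.2 h0)) _
  have hpneg : ∀ t, H < t → p t < 0 := by
    intro t ht
    have : 1 < t / H := (one_lt_div hH0).2 ht
    exact mul_neg_of_pos_of_neg hw (by linarith)
  have hppos : ∀ t, t < H → 0 < p t := by
    intro t ht
    have : t / H < 1 := (div_lt_one hH0).2 ht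
    exact mul_pos hw (by linarith)
  have hpH : p H = 0 := by simp [hp, hH0.ne']
  have hsign : ∀ t, 0 < t → 0 ≤ (t - c) * (l t - f t) ∧
      (t < H → t ≠ c → 0 < (t - c) * (l t - f t)) := by
    intro t ht
    rcases lt_trichotomy t c with h | h | h
    · have h2 := hlow t ht h
      rcases lt_or_ge H t with h3 | h3
      · rw [hout t h3]
        exact ⟨mul_nonneg_of_nonpos_of_nonpos (by linarith) (by linarith [hf0 t]),
          fun h4 => by linarith⟩
      · rw [hin t ht h3]
        have := mul_pos_of_neg_of_neg (sub_neg.2 h) (sub_neg.2 h2)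
        exact ⟨this.le, fun _ _ => this⟩
    · simp [h]
    · rcases lt_trichotomy t H with h3 | h3 | h3
      · rw [hin t ht h3.le]
        have h5 : f t < p t := by
          rcases hhigh t ht h with h4 | h4
          · rw [h4]; exact hppos t h3
          · exact h4
        have := mul_pos (sub_pos.2 h) (sub_pos.2 h5)
        exact ⟨this.le, fun _ _ => this⟩
      · refine ⟨mul_nonneg (by linarith) ?_, fun h4 => by linarith⟩
        rw [hin t ht h3.le]
        rcases hhigh t ht h with h4 | h4
        · rw [h4, h3, hpH]; simp
        · linarith
      · refine ⟨mul_nonneg (by linarith) ?_, fun h4 => by linarith⟩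
        rw [hout t h3]
        rcases hhigh t ht h with h4 | h4
        · rw [h4]; simp
        · linarith [hpneg t h3, hf0 t]
  have hexp : (fun t => (t - c) * (l t - f t)) =
      fun t => (t * l t - t * f t) - c * (l t - f t) := by ext t; ring
  have hDi : IntegrableOn (fun t => (t - c) * (l t - f t)) (Set.Ioi 0) := by
    rw [hexp]; exact (hli'.sub hfi').sub ((hli.sub hfi).const_mul c)
  -- Since l and f have equal area, this integral is the difference of their moments, whatever c is.
  have hpos : 0 < ∫ t in Set.Ioi 0, (t - c) * (l t - f t) := by
    rw [setIntegral_pos_iff_support_of_nonneg_ae _ hDi]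
    · have hsub : Set.Ioo 0 H \ {c} ⊆
          (Function.support fun t => (t - c) * (l t - f t)) ∩ Set.Ioi 0 := fun t ht =>
        ⟨((hsign t ht.1.1).2 ht.1.2 ht.2).ne', ht.1.1⟩
      refine lt_of_lt_of_le ?_ (measure_mono hsub)
      rw [measure_sdiff_null (measure_singleton c), Real.volume_Ioo]
      simpa using hH0
    · filter_upwards [ae_restrict_mem measurableSet_Ioi] with t ht
      exact (hsign t ht).1
  rw [hexp, integral_sub_sub_mul_sub hli' hfi' hli hfi, hl1, hl2] at hpos
  have hAH : w * H / 2 = ∫ x in Set.Ioi 0, f x := by rw [hH]; field_simp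
  rw [hAH, sub_self, mul_zero] at hpos
  linarith

/-- If the upper profile exceeds the linear one near the base, the opposite profile is too small. -/
lemma upper_profile_le {f g : ℝ → ℝ} {w : ℝ} (hw : 0 < w)
    (hfi : IntegrableOn f (Set.Ioi 0))
    (hA : 0 < ∫ x in Set.Ioi 0, f x)
    (h2 : ∀ z, 0 < z → w < g z → ∃ k, (g z - w) / z ≤ k ∧
      ∀ t, 0 < t → f t ≤ max 0 (min w (w - (g z - w) - k * (t - z))))
    {H : ℝ} (hH : H = 2 * (∫ x in Set.Ioi 0, f x) / w) {z : ℝ} (hz : 0 < z) (hzH : z ≤ H / 2) :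
    g z ≤ w * (1 + z / H) := by
  by_contra hcon
  push Not at hcon
  have hH0 : 0 < H := by rw [hH]; positivity
  have hzH' : 0 < z / H := by positivity
  obtain ⟨k, hk, hf⟩ := h2 z hz (by nlinarith)
  set G := g z - w with hG
  have hG0 : w * z / H < G := by
    have : w * (1 + z / H) = w + w * z / H := by ring
    linarith
  have hG1 : 0 < G := lt_trans (by positivity) hG0
  have hk0 : 0 < k := lt_of_lt_of_le (by positivity) hk
  have hGk : G ≤ k * z := (div_le_iff₀ hz).1 hk
  -- The bound on f is w up to a, where the line of slope −k through (z, w − G) reaches w, and then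
  -- falls linearly to 0 at b. The hypothesis k ≥ G/z gives a ≥ 0.
  set a := z - G / k with ha
  have ha0 : 0 ≤ a := by rw [ha, sub_nonneg, div_le_iff₀ hk0]; linarith
  have hka : k * a = k * z - G := by rw [ha]; field_simp
  set b := a + w / k with hb
  have hab : a ≤ b := by rw [hb]; have : 0 < w / k := by positivity
                         linarith
  have hkb : k * b = k * a + w := by rw [hb]; field_simp
  set m : ℝ → ℝ := fun x => (Set.Ioc 0 a).indicator (fun _ => w) x +
    (Set.Ioc a b).indicator (fun x => w - k * (x - a)) x with hm
  have hi1 : IntegrableOn ((Set.Ioc 0 a).indicator (fun _ => w)) (Set.Ioi 0) :=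
    integrableOn_indicator_Ioc continuous_const
  have hi2 : IntegrableOn ((Set.Ioc a b).indicator (fun x => w - k * (x - a))) (Set.Ioi 0) :=
    integrableOn_indicator_Ioc (by fun_prop)
  have hfm : ∀ x, 0 < x → f x ≤ m x := by
    intro x hx
    refine (hf x hx).trans ?_
    have e : w - G - k * (x - z) = w - k * (x - a) := by linarith
    rw [e]
    simp only [hm]
    rcases le_or_gt x a with h | h
    · rw [Set.indicator_of_mem (show x ∈ Set.Ioc 0 a from ⟨hx, h⟩),
        Set.indicator_of_notMem fun h' => absurd h'.1 (not_lt.2 h), add_zero]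
      exact max_le hw.le (min_le_left _ _)
    · rw [Set.indicator_of_notMem fun h' => absurd h'.2 (not_le.2 h), zero_add]
      rcases le_or_gt x b with h' | h'
      · rw [Set.indicator_of_mem (show x ∈ Set.Ioc a b from ⟨h, h'⟩)]
        refine max_le ?_ (min_le_right _ _)
        nlinarith
      · rw [Set.indicator_of_notMem fun h'' => absurd h''.2 (not_le.2 h')]
        refine max_le le_rfl ((min_le_right _ _).trans ?_)
        nlinarith
  have hle : ∫ x in Set.Ioi 0, f x ≤ ∫ x in Set.Ioi 0, m x :=
    setIntegral_mono_on hfi (hi1.add hi2) measurableSet_Ioi hfm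
  have hmi : ∫ x in Set.Ioi 0, m x = w * a + w ^ 2 / (2 * k) := by
    simp only [hm]
    rw [integral_add hi1 hi2, setIntegral_indicator_Ioc le_rfl ha0,
      setIntegral_indicator_Ioc ha0 hab, intervalIntegral.integral_const]
    have : ∀ x, w - k * (x - a) = (w + k * a) - k * x := fun x => by ring
    simp_rw [this]
    rw [intervalIntegral.integral_sub (by simp) (Continuous.intervalIntegrable (by fun_prop) _ _),
      intervalIntegral.integral_const, intervalIntegral.integral_const_mul, integral_id, hb]
    simp only [smul_eq_mul]
    field_simp; ring
  rw [hmi] at hle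
  have hAH : ∫ x in Set.Ioi 0, f x = w * H / 2 := by rw [hH]; field_simp
  rw [hAH] at hle
  -- `w / k < H - H * a / z` and `2 * a ≤ H * a / z`
  have e1 : w * z < k * (z - a) * H := by
    rw [div_lt_iff₀ hH0] at hG0; nlinarith
  have e2 : w ^ 2 / (2 * k) < w * (H - H * a / z) / 2 := by
    rw [div_lt_div_iff₀ (by positivity) (by norm_num)]
    have e3 : H - H * a / z = (z - a) * H / z := by field_simp
    rw [e3]
    have e4 : w < k * ((z - a) * H / z) := by rw [← mul_div_assoc, lt_div_iff₀ hz]; linarith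
    nlinarith
  have e5 : 2 * a ≤ H * a / z := by
    rw [le_div_iff₀ hz]; nlinarith
  nlinarith

/-- One-dimensional form of the area bound. -/
lemma area_lt_of_profiles {f g : ℝ → ℝ} {N : Set ℝ} {w : ℝ} (hw : 0 < w)
    (hf0 : ∀ x, 0 ≤ f x) (hg0 : ∀ x, 0 ≤ g x) (hfi : IntegrableOn f (Set.Ioi 0))
    (hfi' : IntegrableOn (fun x => x * f x) (Set.Ioi 0)) (hgi : IntegrableOn g (Set.Ioi 0))
    (hgi' : IntegrableOn (fun x => x * g x) (Set.Ioi 0))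
    (hNb : BddAbove N) (hfN : ∀ x, 0 < x → x ∉ N → f x = 0)
    (hA : 0 < ∫ x in Set.Ioi 0, f x)
    (h1 : ∀ s ∈ N, ∀ t, 0 < t → t < s → ∃ r, 0 ≤ r ∧ r < t / s ∧ w + r * min 0 (f s - w) ≤ f t)
    (h2 : ∀ z, 0 < z → w < g z → ∃ k, (g z - w) / z ≤ k ∧
      ∀ t, 0 < t → f t ≤ max 0 (min w (w - (g z - w) - k * (t - z))))
    (hM : ∫ x in Set.Ioi 0, x * f x = ∫ x in Set.Ioi 0, x * g x) :
    ∫ x in Set.Ioi 0, g x < 5 / 4 * ∫ x in Set.Ioi 0, f x := by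
  obtain ⟨H, hH⟩ : ∃ H, H = 2 * (∫ x in Set.Ioi 0, f x) / w := ⟨_, rfl⟩
  have hH0 : 0 < H := by rw [hH]; positivity
  have hmom := moment_lt_of_profile hw hf0 hfi hfi' hNb hfN hA h1 hH
  have hup := fun z hz hzH => upper_profile_le (g := g) hw hfi hA h2 hH (z := z) hz hzH
  set p : ℝ → ℝ := fun x => w * (1 + x / H) with hp
  -- The cut at H/2 makes the moment of the trapezoid equal to wH²/6, that of the triangle on the
  -- other side.
  set l : ℝ → ℝ := (Set.Ioc 0 (H / 2)).indicator p with hl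
  have hli : IntegrableOn l (Set.Ioi 0) := integrableOn_indicator_Ioc (by fun_prop)
  have hxl : (fun x => x * l x) = (Set.Ioc 0 (H / 2)).indicator (fun x => x * p x) := by
    ext x; by_cases hx : x ∈ Set.Ioc 0 (H / 2) <;> simp [hl, hx]
  have hli' : IntegrableOn (fun x => x * l x) (Set.Ioi 0) := by
    rw [hxl]; exact integrableOn_indicator_Ioc (by fun_prop)
  have hl1 : ∫ x in Set.Ioi 0, l x = 5 / 8 * (w * H) := by
    rw [hl, setIntegral_indicator_Ioc le_rfl (by positivity)]
    simp only [hp]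
    rw [intervalIntegral.integral_const_mul, intervalIntegral.integral_add (by simp)
      (Continuous.intervalIntegrable (by fun_prop) _ _), intervalIntegral.integral_div]
    simp only [intervalIntegral.integral_const, integral_id, smul_eq_mul]
    field_simp; ring
  have hl2 : ∫ x in Set.Ioi 0, x * l x = w * H ^ 2 / 6 := by
    rw [hxl, setIntegral_indicator_Ioc le_rfl (by positivity)]
    have : ∀ x, x * p x = w * x + w / H * x ^ 2 := fun x => by simp only [hp]; ring
    simp_rw [this]
    rw [intervalIntegral.integral_add (Continuous.intervalIntegrable (by fun_prop) _ _)
      (Continuous.intervalIntegrable (by fun_prop) _ _), intervalIntegral.integral_const_mul,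
      intervalIntegral.integral_const_mul, integral_pow, integral_id]
    field_simp; ring
  have hexp : (fun t => (t - H / 2) * (g t - l t)) =
      fun t => (t * g t - t * l t) - H / 2 * (g t - l t) := by ext t; ring
  -- Below H/2 one has g ≤ l, and beyond it l = 0 ≤ g. Hence a deficit of moment of g against l
  -- forces a deficit of area.
  have hnn : 0 ≤ ∫ t in Set.Ioi 0, (t - H / 2) * (g t - l t) := by
    refine setIntegral_nonneg measurableSet_Ioi fun t ht => ?_
    rcases le_or_gt t (H / 2) with h | h
    · rw [hl, Set.indicator_of_mem (show t ∈ Set.Ioc 0 (H / 2) from ⟨ht, h⟩)]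
      exact mul_nonneg_of_nonpos_of_nonpos (by linarith) (sub_nonpos.2 (hup t ht h))
    · rw [hl, Set.indicator_of_notMem fun h' => absurd h'.2 (not_le.2 h), sub_zero]
      exact mul_nonneg (by linarith) (hg0 t)
  rw [hexp, integral_sub_sub_mul_sub hgi' hli' hgi hli, hl1, hl2, ← hM] at hnn
  have hAH : ∫ x in Set.Ioi 0, f x = w * H / 2 := by rw [hH]; field_simp
  rw [hAH]
  nlinarith

/-! ### Slices of a convex disk along parallels of latitude -/

section

/-- The longitudes of the points of `K` at the level where the latitude has tangent `s`. -/
def lonSlice (b : OrthonormalBasis (Fin 3) ℝ E3) (K : Set Sph2) (s : ℝ) : Set ℝ :=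
  {t | t ∈ Set.Ioo (-(Real.pi / 2)) (Real.pi / 2) ∧
    frameVec b (Real.cos t, Real.sin t, s) ∈ cone K}

/-- A convex disk in the open hemisphere centred at the first frame vector, which is an interior
direction of its cone. -/
structure InFrame (b : OrthonormalBasis (Fin 3) ℝ E3) (K : Set Sph2) : Prop where
  disk : IsConvexDisk K
  pos : ∀ u ∈ K, 0 < inner ℝ (b 0) (u : E3)
  mem : b 0 ∈ interior (cone K)

variable {b : OrthonormalBasis (Fin 3) ℝ E3} {K : Set Sph2}

lemma InFrame.cone_pos (h : InFrame b K) {x : E3} (hx : x ∈ cone K) : 0 < inner ℝ (b 0) x := by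
  obtain ⟨r, hr, u, hu, rfl⟩ := hx
  rw [inner_smul_right]
  exact mul_pos hr (h.pos u hu)

lemma InFrame.first_pos (h : InFrame b K) {x y z : ℝ} (hx : frameVec b (x, y, z) ∈ cone K) :
    0 < x := by
  have := h.cone_pos hx
  rwa [inner_frame_zero] at this

lemma InFrame.base_mem (h : InFrame b K) : frameVec b (1, 0, 0) ∈ cone K := by
  have : frameVec b (1, 0, 0) = b 0 := by simp [frameVec]
  rw [this]; exact interior_subset h.mem

lemma InFrame.add_mem (h : InFrame b K) {x y z x' y' z' : ℝ} (h1 : frameVec b (x, y, z) ∈ cone K)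
    (h2 : frameVec b (x', y', z') ∈ cone K) : frameVec b (x + x', y + y', z + z') ∈ cone K := by
  have := h.disk.isConvex.add_mem_cone h1 h2
  rwa [← frameVec_add] at this

lemma frameVec_smul_mem {x y z r : ℝ} (h1 : frameVec b (x, y, z) ∈ cone K) (hr : 0 < r) :
    frameVec b (r * x, r * y, r * z) ∈ cone K := by
  have := smul_mem_cone h1 hr
  rwa [← frameVec_smul] at this

lemma InFrame.smul_add_smul_mem (h : InFrame b K) {x y z x' y' z' r s : ℝ}
    (h1 : frameVec b (x, y, z) ∈ cone K) (h2 : frameVec b (x', y', z') ∈ cone K)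
    (hr : 0 ≤ r) (hs : 0 < s) :
    frameVec b (r * x + s * x', r * y + s * y', r * z + s * z') ∈ cone K := by
  rcases hr.eq_or_lt with rfl | hr
  · simpa using frameVec_smul_mem h2 hs
  · exact h.add_mem (frameVec_smul_mem h1 hr) (frameVec_smul_mem h2 hs)

/-- Parallels are not geodesics, so convexity alone does not suffice. The convex combination of the
two given vectors whose second coordinate is sin m has first coordinate at most cos m; adding a
multiple of `b 0`, which lies in the cone, makes up the difference. -/
lemma InFrame.ordConnected_lonSlice (h : InFrame b K) (s : ℝ) : (lonSlice b K s).OrdConnected := by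
  refine Set.ordConnected_iff.2 fun p hp q hq hpq m hm => ?_
  obtain ⟨⟨hp1, hp2⟩, hpK⟩ := hp
  obtain ⟨⟨hq1, hq2⟩, hqK⟩ := hq
  obtain ⟨hm1, hm2⟩ := hm
  have hmI : m ∈ Set.Ioo (-(Real.pi / 2)) (Real.pi / 2) := ⟨by linarith, by linarith⟩
  refine ⟨hmI, ?_⟩
  rcases hm1.eq_or_lt with rfl | hm1
  · exact hpK
  have hsin : StrictMonoOn Real.sin (Set.Icc (-(Real.pi / 2)) (Real.pi / 2)) := Real.strictMonoOn_sin
  have s1 : Real.sin p < Real.sin m := hsin ⟨hp1.le, hp2.le⟩ ⟨hmI.1.le, hmI.2.le⟩ hm1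
  have s2 : Real.sin m ≤ Real.sin q := hsin.monotoneOn ⟨hmI.1.le, hmI.2.le⟩ ⟨hq1.le, hq2.le⟩ hm2
  set β := (Real.sin m - Real.sin p) / (Real.sin q - Real.sin p) with hβ
  have hβ0 : 0 < β := div_pos (by linarith) (by linarith)
  have hβ1 : β ≤ 1 := (div_le_one (by linarith)).2 (by linarith)
  have e1 : (1 - β) * Real.sin p + β * Real.sin q = Real.sin m := by
    have : Real.sin q - Real.sin p ≠ 0 := by linarith
    rw [hβ]; field_simp; ring
  have cp := Real.cos_pos_of_mem_Ioo ⟨hp1, hp2⟩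
  have cq := Real.cos_pos_of_mem_Ioo ⟨hq1, hq2⟩
  have cm := Real.cos_pos_of_mem_Ioo hmI
  have hc : (1 - β) * Real.cos p + β * Real.cos q ≤ Real.cos m := by
    refine (abs_le_of_sq_le_sq' ?_ cm.le).2
    have i1 := Real.sin_sq_add_cos_sq p
    have i2 := Real.sin_sq_add_cos_sq q
    have i3 := Real.sin_sq_add_cos_sq m
    have i4 : 0 ≤ β * (1 - β) * ((Real.sin p - Real.sin q) ^ 2 + (Real.cos p - Real.cos q) ^ 2) :=
      mul_nonneg (mul_nonneg hβ0.le (by linarith)) (by positivity)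
    have i5 : Real.cos m ^ 2 = 1 - ((1 - β) * Real.sin p + β * Real.sin q) ^ 2 := by
      rw [e1]; linarith
    rw [i5]
    nlinarith
  have hcomb := h.smul_add_smul_mem hpK hqK (sub_nonneg.2 hβ1) hβ0
  rw [e1, show (1 - β) * s + β * s = s by ring] at hcomb
  have := h.smul_add_smul_mem h.base_mem hcomb (sub_nonneg.2 hc) one_pos
  simpa using this

/-- The open interval of longitudes may be closed up: at ±π/2 the first coordinate vanishes, which
is impossible on the cone over K. -/
lemma InFrame.isCompact_lonSlice (h : InFrame b K) (s : ℝ) : IsCompact (lonSlice b K s) := by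
  have hne : ∀ t : ℝ, frameVec b (Real.cos t, Real.sin t, s) ≠ 0 := by
    intro t h0
    have := norm_sq_frameVec b (Real.cos t, Real.sin t, s)
    rw [h0] at this
    simp only [norm_zero] at this
    nlinarith [Real.sin_sq_add_cos_sq t, sq_nonneg s]
  have hcont : Continuous fun t : ℝ => frameVec b (Real.cos t, Real.sin t, s) :=
    (continuous_frameVec b).comp (by fun_prop)
  let φ : ℝ → Sph2 := fun t => ⟨‖frameVec b (Real.cos t, Real.sin t, s)‖⁻¹ •
    frameVec b (Real.cos t, Real.sin t, s), by
      rw [mem_sphere_zero_iff_norm, norm_smul, norm_inv, norm_norm,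
        inv_mul_cancel₀ (norm_ne_zero_iff.2 (hne t))]⟩
  have hφ : Continuous φ := Continuous.subtype_mk
    ((hcont.norm.inv₀ fun t => norm_ne_zero_iff.2 (hne t)).smul hcont) _
  have heq : lonSlice b K s = Set.Icc (-(Real.pi / 2)) (Real.pi / 2) ∩ φ ⁻¹' K := by
    ext t
    have hmem : φ t ∈ K ↔ frameVec b (Real.cos t, Real.sin t, s) ∈ cone K := by
      rw [← coe_mem_cone_iff]
      exact smul_mem_cone_iff (inv_pos.2 (norm_pos_iff.2 (hne t)))
    constructor
    · rintro ⟨h1, h2⟩; exact ⟨⟨h1.1.le, h1.2.le⟩, hmem.2 h2⟩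
    · rintro ⟨h1, h2⟩
      have h3 := hmem.1 h2
      have hcos := h.first_pos h3
      refine ⟨⟨lt_of_le_of_ne h1.1 ?_, lt_of_le_of_ne h1.2 ?_⟩, h3⟩
      · rintro rfl; simp at hcos
      · rintro rfl; simp at hcos
  rw [heq]
  exact isCompact_Icc.inter_right (h.disk.isCompact.isClosed.preimage hφ)

lemma InFrame.lonSlice_eq_Icc (h : InFrame b K) {s : ℝ} (hs : (lonSlice b K s).Nonempty) :
    ∃ p q, p ≤ q ∧ lonSlice b K s = Set.Icc p q ∧ p ∈ lonSlice b K s ∧ q ∈ lonSlice b K s := by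
  have h1 := eq_Icc_of_connected_compact
    ⟨hs, (h.ordConnected_lonSlice s).isPreconnected⟩ (h.isCompact_lonSlice s)
  have hle : sInf (lonSlice b K s) ≤ sSup (lonSlice b K s) := by
    by_contra hcon
    rw [Set.Icc_eq_empty hcon] at h1
    exact hs.ne_empty h1
  exact ⟨_, _, hle, h1, (h.isCompact_lonSlice s).sInf_mem hs, (h.isCompact_lonSlice s).sSup_mem hs⟩

lemma InFrame.lonSlice_zero (h : InFrame b K) :
    ∃ α β, α < 0 ∧ 0 < β ∧ lonSlice b K 0 = Set.Icc α β ∧ α ∈ lonSlice b K 0 ∧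
      β ∈ lonSlice b K 0 := by
  have hpi := Real.pi_pos
  have hcont : ContinuousAt (fun t : ℝ => frameVec b (Real.cos t, Real.sin t, 0)) 0 :=
    ((continuous_frameVec b).comp (by fun_prop)).continuousAt
  have h0 : frameVec b (Real.cos 0, Real.sin 0, 0) = b 0 := by simp [frameVec]
  have hev : lonSlice b K 0 ∈ nhds (0 : ℝ) := by
    have hn : interior (cone K) ∈ nhds (frameVec b (Real.cos 0, Real.sin 0, 0)) := by
      rw [h0]; exact isOpen_interior.mem_nhds h.mem
    filter_upwards [hcont hn,
      Ioo_mem_nhds (show -(Real.pi / 2) < 0 by linarith) (show 0 < Real.pi / 2 by linarith)]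
      with t ht1 ht2
    exact ⟨ht2, interior_subset ht1⟩
  obtain ⟨p, q, -, heq, hp, hq⟩ := h.lonSlice_eq_Icc ⟨0, mem_of_mem_nhds hev⟩
  have hint : (0 : ℝ) ∈ interior (Set.Icc p q) := by
    rw [← heq]; exact mem_interior_iff_mem_nhds.2 hev
  rw [interior_Icc] at hint
  exact ⟨p, q, hint.1, hint.2, heq, hp, hq⟩

lemma mem_Ioo_of_cos_pos {t : ℝ} (h1 : -Real.pi < t) (h2 : t < Real.pi) (hc : 0 < Real.cos t) :
    t ∈ Set.Ioo (-(Real.pi / 2)) (Real.pi / 2) := by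
  have hpi := Real.pi_pos
  constructor
  · by_contra hcon
    have := Real.cos_nonpos_of_pi_div_two_le_of_le (x := -t) (by linarith) (by linarith)
    rw [Real.cos_neg] at this; linarith
  · by_contra hcon
    have := Real.cos_nonpos_of_pi_div_two_le_of_le (x := t) (by linarith) (by linarith)
    linarith

/-- Segments from a base point to a point at level `s` meet the level `r * s`. -/
lemma InFrame.lonScale_mem (h : InFrame b K) {u q s r : ℝ} (hu : u ∈ lonSlice b K 0)
    (hq : q ∈ lonSlice b K s) (hr0 : 0 < r) (hr1 : r < 1) :
    u + lonScale r (q - u) ∈ lonSlice b K (r * s) := by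
  obtain ⟨⟨hu1, hu2⟩, huK⟩ := hu
  obtain ⟨-, hqK⟩ := hq
  set τ := lonScale r (q - u) with hτ
  have hab := abs_lt.1 (abs_mul_sin_lt_one hr0.le hr1 (q - u))
  have hsin : Real.sin τ = r * Real.sin (q - u) := Real.sin_arcsin hab.1.le hab.2.le
  have hcos : Real.cos τ = √(1 - (r * Real.sin (q - u)) ^ 2) := Real.cos_arcsin _
  -- Taken with weight r on the point at level s, this weight on the base point gives a combination
  -- of longitude u + τ at level r s, because sin τ = r sin(q − u).
  have hα : 0 < Real.cos τ - r * Real.cos (q - u) := by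
    rw [hcos, sub_pos]
    refine lt_of_le_of_lt (le_abs_self _) ?_
    rw [← Real.sqrt_sq_eq_abs]
    refine Real.sqrt_lt_sqrt (sq_nonneg _) ?_
    have e : (r * Real.cos (q - u)) ^ 2 + (r * Real.sin (q - u)) ^ 2 = r ^ 2 := by
      rw [mul_pow, mul_pow, ← mul_add, Real.cos_sq_add_sin_sq, mul_one]
    nlinarith
  have hmem := h.smul_add_smul_mem huK hqK hα.le hr0
  have e1 : (Real.cos τ - r * Real.cos (q - u)) * Real.cos u + r * Real.cos q =
      Real.cos (u + τ) := by
    have : Real.cos q = Real.cos (q - u) * Real.cos u - Real.sin (q - u) * Real.sin u := by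
      rw [← Real.cos_add]; congr 1; ring
    rw [this, Real.cos_add, hsin]; ring
  have e2 : (Real.cos τ - r * Real.cos (q - u)) * Real.sin u + r * Real.sin q =
      Real.sin (u + τ) := by
    have : Real.sin q = Real.sin (q - u) * Real.cos u + Real.cos (q - u) * Real.sin u := by
      rw [← Real.sin_add]; congr 1; ring
    rw [this, Real.sin_add, hsin]; ring
  rw [e1, e2, mul_zero, zero_add] at hmem
  have l1 : -(Real.pi / 2) ≤ τ := Real.neg_pi_div_two_le_arcsin _
  have l2 : τ ≤ Real.pi / 2 := Real.arcsin_le_pi_div_two _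
  exact ⟨mem_Ioo_of_cos_pos (by linarith) (by linarith) (h.first_pos hmem), hmem⟩

/-- The segment between points on either side of the equator crosses it in the base. -/
lemma InFrame.exists_crossing (h : InFrame b K) {q v s y : ℝ} (hq : q ∈ lonSlice b K s)
    (hv : v ∈ lonSlice b K (-y)) (hs : 0 < s) (hy : 0 < y) :
    ∃ t ∈ lonSlice b K 0, ∃ R, 0 < R ∧ ∀ x,
      y * Real.sin (q - x) + s * Real.sin (v - x) = R * Real.sin (t - x) := by
  -- The weights y and s cancel the levels s and −y, leaving a vector in the plane of the equator; t
  -- is its longitude.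
  have hmem := h.smul_add_smul_mem hq.2 hv.2 hy.le hs
  rw [show y * s + s * -y = 0 by ring] at hmem
  set X := y * Real.cos q + s * Real.cos v with hX
  set Y := y * Real.sin q + s * Real.sin v with hY
  have hX0 : 0 < X := h.first_pos hmem
  set t := Real.arctan (Y / X) with ht
  have hct : 0 < Real.cos t := Real.cos_arctan_pos _
  have htan : Real.sin t = Y / X * Real.cos t := by
    rw [← Real.tan_mul_cos hct.ne', Real.tan_arctan]
  refine ⟨t, ⟨⟨Real.neg_pi_div_two_lt_arctan _, Real.arctan_lt_pi_div_two _⟩, ?_⟩,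
    X / Real.cos t, by positivity, fun x => ?_⟩
  · have := frameVec_smul_mem hmem (r := Real.cos t / X) (by positivity)
    rw [div_mul_cancel₀ _ hX0.ne', mul_zero,
      show Real.cos t / X * Y = Real.sin t by rw [htan]; ring] at this
    exact this
  · rw [Real.sin_sub, Real.sin_sub, Real.sin_sub, htan]
    have : X / Real.cos t * (Y / X * Real.cos t * Real.cos x - Real.cos t * Real.sin x) =
      Y * Real.cos x - X * Real.sin x := by field_simp
    rw [this, hX, hY]; ring

/-- The crossing longitude t is at most β, so sin(t − β) ≤ 0 in the crossing identity at x = β. The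
left end is symmetric. -/
lemma InFrame.sin_right_le (h : InFrame b K) {α β q v s y : ℝ} (hαβ : lonSlice b K 0 = Set.Icc α β)
    (hβ : β ∈ lonSlice b K 0) (hq : q ∈ lonSlice b K s)
    (hv : v ∈ lonSlice b K (-y)) (hs : 0 < s) (hy : 0 < y) :
    Real.sin (v - β) ≤ -(y / s * Real.sin (q - β)) := by
  obtain ⟨t, ht, R, hR, hx⟩ := h.exists_crossing hq hv hs hy
  have ht1 : t ≤ β := (hαβ ▸ ht).2
  have h1 := hx β
  have h2 : Real.sin (t - β) ≤ 0 :=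
    Real.sin_nonpos_of_nonpos_of_neg_pi_le (by linarith) (by linarith [ht.1.1, hβ.1.2])
  have h3 : y * Real.sin (q - β) + s * Real.sin (v - β) ≤ 0 := by
    rw [h1]; exact mul_nonpos_of_nonneg_of_nonpos hR.le h2
  rw [div_mul_eq_mul_div, ← neg_div, le_div_iff₀ hs]
  linarith

lemma InFrame.sin_left_ge (h : InFrame b K) {α β q v s y : ℝ} (hαβ : lonSlice b K 0 = Set.Icc α β)
    (hα : α ∈ lonSlice b K 0) (hq : q ∈ lonSlice b K s)
    (hv : v ∈ lonSlice b K (-y)) (hs : 0 < s) (hy : 0 < y) :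
    -(y / s * Real.sin (q - α)) ≤ Real.sin (v - α) := by
  obtain ⟨t, ht, R, hR, hx⟩ := h.exists_crossing hq hv hs hy
  have ht1 : α ≤ t := (hαβ ▸ ht).1
  have h1 := hx α
  have h2 : 0 ≤ Real.sin (t - α) :=
    Real.sin_nonneg_of_nonneg_of_le_pi (by linarith) (by linarith [ht.1.2, hα.1.1])
  have h3 : 0 ≤ y * Real.sin (q - α) + s * Real.sin (v - α) := by
    rw [h1]; exact mul_nonneg hR.le h2
  rw [div_mul_eq_mul_div, ← neg_div, div_le_iff₀ hs]
  linarith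

lemma le_neg_arcsin {τ m : ℝ} (hτ : τ ≤ Real.pi / 2) (h : Real.sin τ ≤ -m) :
    τ ≤ -Real.arcsin m := by
  rw [← Real.arcsin_neg]
  rcases le_or_gt (-(Real.pi / 2)) τ with h1 | h1
  · rw [← Real.arcsin_sin h1 hτ]; exact Real.monotone_arcsin h
  · exact h1.le.trans (Real.neg_pi_div_two_le_arcsin _)

lemma neg_arcsin_le {τ m : ℝ} (hτ : -(Real.pi / 2) ≤ τ) (h : -m ≤ Real.sin τ) :
    -Real.arcsin m ≤ τ := by
  have := le_neg_arcsin (τ := -τ) (m := -m) (by linarith) (by rw [Real.sin_neg]; linarith)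
  rw [Real.arcsin_neg] at this; linarith

/-- The length of the slice of `K` at height `z`. -/
noncomputable def profile (b : OrthonormalBasis (Fin 3) ℝ E3) (K : Set Sph2) (z : ℝ) : ℝ :=
  volume.real {t | (t, z) ∈ cylDom ∩ cyl b ⁻¹' K}

lemma slice_eq_lonSlice {z : ℝ} (hz : z ∈ Set.Ioo (-1 : ℝ) 1) :
    {t | (t, z) ∈ cylDom ∩ cyl b ⁻¹' K} = lonSlice b K (tanArcsin z) := by
  ext t
  have key : (t, z) ∈ cylDom → (cyl b (t, z) ∈ K ↔
      frameVec b (Real.cos t, Real.sin t, tanArcsin z) ∈ cone K) := by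
    intro h
    rw [← coe_mem_cone_iff, coe_cyl b h]
    exact smul_mem_cone_iff (sqrt_one_sub_sq_pos hz)
  constructor
  · rintro ⟨h1, h2⟩; exact ⟨h1.1, (key h1).1 h2⟩
  · rintro ⟨h1, h2⟩; exact ⟨⟨h1, hz⟩, (key ⟨h1, hz⟩).2 h2⟩

lemma slice_eq_empty {z : ℝ} (hz : z ∉ Set.Ioo (-1 : ℝ) 1) :
    {t | (t, z) ∈ cylDom ∩ cyl b ⁻¹' K} = ∅ :=
  Set.eq_empty_of_forall_notMem fun _ h => hz h.1.2

lemma profile_nonneg (z : ℝ) : 0 ≤ profile b K z := measureReal_nonneg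

lemma profile_eq_zero {z : ℝ} (hz : z ∉ Set.Ioo (-1 : ℝ) 1) : profile b K z = 0 := by
  rw [profile, slice_eq_empty hz]; simp

lemma profile_eq {z p q : ℝ} (hz : z ∈ Set.Ioo (-1 : ℝ) 1) (hpq : p ≤ q)
    (h : lonSlice b K (tanArcsin z) = Set.Icc p q) : profile b K z = q - p := by
  rw [profile, slice_eq_lonSlice hz, h, Real.volume_real_Icc_of_le hpq]

lemma InFrame.sub_le_profile (h : InFrame b K) {z p q : ℝ} (hz : z ∈ Set.Ioo (-1 : ℝ) 1)
    (hp : p ∈ lonSlice b K (tanArcsin z)) (hq : q ∈ lonSlice b K (tanArcsin z)) :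
    q - p ≤ profile b K z := by
  obtain ⟨p', q', hle, heq, -, -⟩ := h.lonSlice_eq_Icc ⟨p, hp⟩
  rw [profile_eq hz hle heq]
  rw [heq] at hp hq
  linarith [hp.1, hq.2]

lemma tanArcsin_neg (z : ℝ) : tanArcsin (-z) = -tanArcsin z := by
  simp [tanArcsin, neg_div]

lemma tanArcsin_zero : tanArcsin 0 = 0 := by simp [tanArcsin]

lemma tanArcsin_pos {z : ℝ} (h0 : 0 < z) (h1 : z < 1) : 0 < tanArcsin z :=
  div_pos h0 (sqrt_one_sub_sq_pos ⟨by linarith, h1⟩)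

/-- Lower bound for the profile between the base and a nonempty slice. -/
lemma InFrame.profile_ge (h : InFrame b K) {s t : ℝ} (ht : 0 < t) (hts : t < s) (hs : s < 1)
    (hne : (lonSlice b K (tanArcsin (-s))).Nonempty) :
    ∃ r, 0 ≤ r ∧ r < t / s ∧
      profile b K 0 + r * min 0 (profile b K (-s) - profile b K 0) ≤ profile b K (-t) := by
  obtain ⟨α, β, hα0, hβ0, heq0, hα, hβ⟩ := h.lonSlice_zero
  obtain ⟨p, q, hpq, heq, hp, hq⟩ := h.lonSlice_eq_Icc hne
  have hs0 := ht.trans hts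
  have hr0 : 0 < tanArcsin t / tanArcsin s :=
    div_pos (tanArcsin_pos ht (hts.trans hs)) (tanArcsin_pos hs0 hs)
  have hr1 := tanArcsin_ratio_lt ht hts hs
  have hr2 : tanArcsin t / tanArcsin s < 1 := hr1.trans ((div_lt_one hs0).2 hts)
  have hlev : tanArcsin t / tanArcsin s * tanArcsin (-s) = tanArcsin (-t) := by
    rw [tanArcsin_neg, tanArcsin_neg, mul_neg, div_mul_cancel₀ _ (tanArcsin_pos hs0 hs).ne']
  set r := tanArcsin t / tanArcsin s
  refine ⟨r, hr0.le, hr1, ?_⟩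
  -- The arcs from α to p and from β to q stay in K, so the slice at height −t is at least as wide
  -- as the gap between them.
  have m1 := h.lonScale_mem hα hp hr0 hr2
  have m2 := h.lonScale_mem hβ hq hr0 hr2
  rw [hlev] at m1 m2
  have h1 := h.sub_le_profile (z := -t) ⟨by linarith, by linarith⟩ m1 m2
  rw [profile_eq (z := 0) (by norm_num) (by linarith) (tanArcsin_zero.symm ▸ heq0),
    profile_eq (z := -s) ⟨by linarith, by linarith⟩ hpq heq]
  have h2 := lonScale_sub_ge (x := q - β) (y := p - α) hr0.le hr2 (by linarith [hq.1.2])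
    (by linarith [hp.1.1])
  rw [show q - β - (p - α) = q - p - (β - α) by ring] at h2
  linarith

/-- Upper bound for the lower profile if the upper one is large somewhere. -/
lemma InFrame.profile_le (h : InFrame b K) {z : ℝ} (hz : 0 < z)
    (hw : profile b K 0 < profile b K z) :
    ∃ k, (profile b K z - profile b K 0) / z ≤ k ∧ ∀ t, 0 < t →
      profile b K (-t) ≤ max 0 (min (profile b K 0)
        (profile b K 0 - (profile b K z - profile b K 0) - k * (t - z))) := by
  obtain ⟨α, β, hα0, hβ0, heq0, hα, hβ⟩ := h.lonSlice_zero
  have hzI : z ∈ Set.Ioo (-1 : ℝ) 1 := by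
    by_contra hcon
    rw [profile_eq_zero hcon] at hw
    exact absurd (profile_nonneg (b := b) (K := K) 0) (not_le.2 hw)
  have hz1 := hzI.2
  have hne : (lonSlice b K (tanArcsin z)).Nonempty := by
    by_contra hcon
    have : profile b K z = 0 := by
      rw [profile, slice_eq_lonSlice hzI, Set.not_nonempty_iff_eq_empty.1 hcon]; simp
    rw [this] at hw
    exact absurd (profile_nonneg (b := b) (K := K) 0) (not_le.2 hw)
  obtain ⟨p, q, hpq, heq, hp, hq⟩ := h.lonSlice_eq_Icc hne
  rw [profile_eq (z := 0) (by norm_num) (by linarith) (tanArcsin_zero.symm ▸ heq0),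
    profile_eq hzI hpq heq] at *
  have hs0 := tanArcsin_pos hz hz1
  have hx : q - β < Real.pi / 2 := by linarith [hq.1.2]
  have hy : -(Real.pi / 2) < p - α := by linarith [hp.1.1]
  have hyx : p - α ≤ q - β := by linarith
  have hg : q - p - (β - α) = q - β - (p - α) := by ring
  have hz2 : 0 < 1 - z ^ 2 := by nlinarith
  -- At r = 0 the tangent inequality says that tan t − t is monotone.
  have htan : q - β - (p - α) ≤ Real.tan (q - β) - Real.tan (p - α) := by
    have := lonScale_tangent (r := 0) le_rfl hy hyx hx (by simp) (by simp)
    simp only [lonScale, zero_mul, Real.arcsin_zero] at this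
    linarith
  set D := Real.tan (q - β) - Real.tan (p - α)
  -- This k combines two tangents: D is the slope in r at r = 1, and 1/(z(1 − z²)) is the slope of r
  -- in t at t = z.
  refine ⟨D / (z * (1 - z ^ 2)), ?_, fun t ht => ?_⟩
  · rw [hg, div_le_div_iff₀ hz (by positivity)]
    have : (q - β - (p - α)) * (1 - z ^ 2) ≤ D := by nlinarith
    nlinarith
  by_cases htne : -t ∈ Set.Ioo (-1 : ℝ) 1 ∧ (lonSlice b K (tanArcsin (-t))).Nonempty
  swap
  · have : profile b K (-t) = 0 := by
      by_cases h1 : -t ∈ Set.Ioo (-1 : ℝ) 1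
      · rw [profile, slice_eq_lonSlice h1,
          Set.not_nonempty_iff_eq_empty.1 fun h2 => htne ⟨h1, h2⟩]; simp
      · exact profile_eq_zero h1
    rw [this]; exact le_max_left _ _
  obtain ⟨htI, htne⟩ := htne
  have ht1 : t < 1 := by linarith [htI.1]
  obtain ⟨p', q', hpq', heq', hp', hq'⟩ := h.lonSlice_eq_Icc htne
  rw [profile_eq htI hpq' heq']
  have ht0 := tanArcsin_pos ht ht1
  rw [tanArcsin_neg] at hp' hq'
  -- Arcs joining the ends of the upper slice to those of the lower one cross the equator within [α,
  -- β], which limits the lower slice on both sides.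
  have c1 := h.sin_right_le heq0 hβ hq hq' hs0 ht0
  have c2 := h.sin_left_ge heq0 hα hp hp' hs0 ht0
  have hr0 : 0 < tanArcsin t / tanArcsin z := by positivity
  have htg := tanArcsin_tangent ⟨hz, hz1⟩ ⟨ht, ht1⟩
  set r := tanArcsin t / tanArcsin z
  have d1 : q' - β ≤ -lonScale r (q - β) := le_neg_arcsin (by linarith [hq'.1.2]) c1
  have d2 : -lonScale r (p - α) ≤ p' - α := neg_arcsin_le (by linarith [hp'.1.1]) c2
  have d3 := lonScale_tangent hr0.le hy hyx hx (by linarith [Real.sin_le_one (p' - α)])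
    (by linarith [Real.neg_one_le_sin (q' - β)])
  have d4 := lonScale_mono hr0.le hy.le hyx hx.le
  refine le_max_of_le_right (le_min (by linarith) ?_)
  have d5 : D / (z * (1 - z ^ 2)) * (t - z) ≤ D * (r - 1) := by
    rw [div_mul_eq_mul_div, mul_div_assoc]
    exact mul_le_mul_of_nonneg_left htg (by linarith)
  linarith

end

/-! ### Slicing by height, and the strict bound 5/4 -/

section

variable {b : OrthonormalBasis (Fin 3) ℝ E3} {K : Set Sph2}

/-- The height of a point of the sphere over the equator. -/
noncomputable def height (b : OrthonormalBasis (Fin 3) ℝ E3) (u : Sph2) : ℝ := inner ℝ (b 2) (u : E3)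

lemma continuous_height : Continuous (height b) := by unfold height; fun_prop

lemma measurableSet_cylDom : MeasurableSet cylDom := measurableSet_Ioo.prod measurableSet_Ioo

lemma measurable_slice_volume (hK : MeasurableSet K) :
    Measurable fun z => volume {t | (t, z) ∈ cylDom ∩ cyl b ⁻¹' K} :=
  measurable_measure_prodMk_right (measurableSet_cylDom.inter (measurable_cyl b hK))

lemma slice_volume_ne_top (z : ℝ) : volume {t | (t, z) ∈ cylDom ∩ cyl b ⁻¹' K} ≠ ⊤ := by
  refine ((measure_mono fun t ht => ht.1.1).trans_lt
    (measure_Ioo_lt_top (a := -(Real.pi / 2)) (b := Real.pi / 2))).ne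

/-- Slicing a subset of the hemisphere by height. -/
lemma map_height (hK : MeasurableSet K) (hpos : ∀ u ∈ K, 0 < inner ℝ (b 0) (u : E3)) :
    (σ.restrict K).map (height b) =
      volume.withDensity fun z => volume {t | (t, z) ∈ cylDom ∩ cyl b ⁻¹' K} := by
  ext B hB
  have hBm : MeasurableSet (height b ⁻¹' B) := continuous_height.measurable hB
  have hsub : height b ⁻¹' B ∩ K =
      height b ⁻¹' B ∩ K ∩ {u : Sph2 | 0 < inner ℝ (b 0) (u : E3)} :=
    (Set.inter_eq_left.2 fun u hu => hpos u hu.2).symm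
  have hM : MeasurableSet (cylDom ∩ cyl b ⁻¹' K) :=
    measurableSet_cylDom.inter (measurable_cyl b hK)
  rw [Measure.map_apply continuous_height.measurable hB, Measure.restrict_apply hBm, hsub,
    ← Measure.restrict_apply (hBm.inter hK), sigma_restrict_eq_map_cyl,
    Measure.map_apply (measurable_cyl b) (hBm.inter hK),
    Measure.restrict_apply (measurable_cyl b (hBm.inter hK)), withDensity_apply _ hB]
  have hset : cyl b ⁻¹' (height b ⁻¹' B ∩ K) ∩ cylDom =
      (cylDom ∩ cyl b ⁻¹' K) ∩ Prod.snd ⁻¹' B := by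
    ext p
    constructor
    · rintro ⟨⟨h1, h2⟩, h3⟩
      refine ⟨⟨h3, h2⟩, ?_⟩
      have h4 : height b (cyl b p) ∈ B := h1
      rwa [height, inner_cyl_two b h3] at h4
    · rintro ⟨⟨h1, h2⟩, h3⟩
      refine ⟨⟨?_, h2⟩, h1⟩
      change height b (cyl b p) ∈ B
      rwa [height, inner_cyl_two b h1]
  rw [hset, Measure.volume_eq_prod, Measure.prod_apply_symm (hM.inter (measurable_snd hB)),
    ← lintegral_indicator hB]
  congr 1
  ext z
  by_cases hz : z ∈ B
  · rw [Set.indicator_of_mem hz]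
    congr 1
    ext t; simp [hz]
  · rw [Set.indicator_of_notMem hz]
    convert measure_empty (μ := (volume : Measure ℝ))
    ext t; simp [hz]

lemma integrable_profile (hK : MeasurableSet K) (hpos : ∀ u ∈ K, 0 < inner ℝ (b 0) (u : E3)) :
    Integrable (profile b K) := by
  refine integrable_toReal_of_lintegral_ne_top (measurable_slice_volume hK).aemeasurable ?_
  rw [← setLIntegral_univ, ← withDensity_apply _ MeasurableSet.univ, ← map_height hK hpos]
  exact measure_ne_top _ _

lemma integrable_mul_profile (hK : MeasurableSet K)
    (hpos : ∀ u ∈ K, 0 < inner ℝ (b 0) (u : E3)) : Integrable fun z => z * profile b K z := by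
  have hi := integrable_profile hK hpos
  refine hi.mono (measurable_id.aestronglyMeasurable.mul hi.1) (Filter.Eventually.of_forall fun z => ?_)
  rw [norm_mul, Real.norm_eq_abs]
  by_cases hz : z ∈ Set.Ioo (-1 : ℝ) 1
  · exact mul_le_of_le_one_left (norm_nonneg _) (abs_le.2 ⟨hz.1.le, hz.2.le⟩)
  · rw [profile_eq_zero hz]; simp

lemma area_inter_height (hK : MeasurableSet K) (hpos : ∀ u ∈ K, 0 < inner ℝ (b 0) (u : E3))
    {B : Set ℝ} (hB : MeasurableSet B) :
    area (K ∩ height b ⁻¹' B) = ∫ z in B, profile b K z := by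
  have hBm : MeasurableSet (height b ⁻¹' B) := continuous_height.measurable hB
  rw [area, measureReal_def, Set.inter_comm, ← Measure.restrict_apply hBm,
    ← Measure.map_apply continuous_height.measurable hB, map_height hK hpos, withDensity_apply _ hB]
  exact (integral_toReal (measurable_slice_volume hK).aemeasurable
    (Filter.Eventually.of_forall fun z => (slice_volume_ne_top z).lt_top)).symm

lemma integral_height (hK : MeasurableSet K) (hpos : ∀ u ∈ K, 0 < inner ℝ (b 0) (u : E3)) :
    ∫ u in K, height b u ∂σ = ∫ z, z * profile b K z := by
  rw [← integral_map (f := fun z => z) continuous_height.aemeasurable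
    aestronglyMeasurable_id, map_height hK hpos, integral_withDensity_eq_integral_toReal_smul
    (measurable_slice_volume hK)
    (Filter.Eventually.of_forall fun z => (slice_volume_ne_top z).lt_top)]
  simp only [smul_eq_mul, mul_comm]
  rfl

/-- The upper part of a convex disk with first moment on the equator has less than `5 / 4` of the
area of the lower part. -/
lemma InFrame.area_lt (h : InFrame b K) (hmom : inner ℝ (b 2) (moment K) = 0) :
    0 < area (K ∩ height b ⁻¹' Set.Iic 0) ∧
      area (K ∩ height b ⁻¹' Set.Ici 0) < 5 / 4 * area (K ∩ height b ⁻¹' Set.Iic 0) := by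
  have hKm := h.disk.measurableSet
  have hi := integrable_profile hKm h.pos
  have hi' := integrable_mul_profile hKm h.pos
  have hlow : area (K ∩ height b ⁻¹' Set.Iic 0) = ∫ x in Set.Ioi 0, profile b K (-x) := by
    rw [area_inter_height hKm h.pos measurableSet_Iic]
    simp
  have hup : area (K ∩ height b ⁻¹' Set.Ici 0) = ∫ x in Set.Ioi 0, profile b K x := by
    rw [area_inter_height hKm h.pos measurableSet_Ici, integral_Ici_eq_integral_Ioi]
  have hpos : 0 < area (K ∩ height b ⁻¹' Set.Iic 0) := by
    -- As `b 0` is interior to the cone, a small step along −`b 2` reaches a point of K strictly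
    -- below the equator.
    have hcont : ContinuousAt (fun d : ℝ => b 0 + d • b 2) 0 := by fun_prop
    have hev : ∀ᶠ d : ℝ in nhds 0, b 0 + d • b 2 ∈ interior (cone K) :=
      hcont.eventually (isOpen_interior.mem_nhds (by simpa using h.mem))
    obtain ⟨d, hd, hd0⟩ := ((hev.filter_mono nhdsWithin_le_nhds).and
      (self_mem_nhdsWithin (a := (0 : ℝ)) (s := Set.Iio 0))).exists
    have hd0' : d < 0 := hd0
    obtain ⟨r, hr, u, hu, he⟩ := interior_subset hd
    have hu0 : height b u < 0 := by
      have h1 := congrArg (fun v => inner ℝ (b 2) v) he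
      simp only [inner_add_right, inner_smul_right, b.inner_eq_ite] at h1
      simp at h1
      change d = r * height b u at h1
      by_contra hcon
      nlinarith [mul_nonneg hr.le (not_lt.1 hcon)]
    have h2 := h.disk.sigma_inter_pos hu (isOpen_lt continuous_height continuous_const) hu0
    rw [area, measureReal_def]
    refine ENNReal.toReal_pos (lt_of_lt_of_le h2 (measure_mono ?_)).ne' (measure_ne_top _ _)
    exact fun v hv => ⟨hv.1, le_of_lt (show height b v < 0 from hv.2)⟩
  refine ⟨hpos, ?_⟩
  obtain ⟨α, β, hα, hβ, heq, -, -⟩ := h.lonSlice_zero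
  have hw : 0 < profile b K 0 := by
    rw [profile_eq (z := 0) (by norm_num) (by linarith) (tanArcsin_zero.symm ▸ heq)]; linarith
  rw [hlow] at hpos
  rw [hlow, hup]
  refine area_lt_of_profiles (N := {s | 0 < s ∧ s < 1 ∧ (lonSlice b K (tanArcsin (-s))).Nonempty})
    hw (fun _ => profile_nonneg _) (fun _ => profile_nonneg _) hi.comp_neg.integrableOn ?_
    hi.integrableOn hi'.integrableOn ⟨1, fun s hs => hs.2.1.le⟩ ?_ hpos ?_
    (fun z hz => h.profile_le hz) ?_
  · have := hi'.comp_neg.neg.integrableOn (s := Set.Ioi 0)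
    refine this.congr (Filter.Eventually.of_forall fun x => ?_)
    simp
  · intro x hx hxN
    by_cases hx1 : x < 1
    · rw [profile, slice_eq_lonSlice ⟨by linarith, by linarith⟩,
        Set.not_nonempty_iff_eq_empty.1 fun h2 => hxN ⟨hx, hx1, h2⟩]; simp
    · exact profile_eq_zero fun h1 => hx1 (by linarith [h1.1])
  · exact fun s hs t ht hts => h.profile_ge ht hts hs.2.1 hs.2.2
  · have hz : ∫ z, z * profile b K z = 0 := by
      rw [← integral_height hKm h.pos, ← hmom, inner_moment]; rfl
    rw [← intervalIntegral.integral_Iic_add_Ioi (b := 0) hi'.integrableOn hi'.integrableOn] at hz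
    have h2 := integral_comp_neg_Ioi (0 : ℝ) fun z => z * profile b K z
    simp only [neg_zero, neg_mul, integral_neg] at h2
    linarith

end

/-! ### Isosceles triangles and integrals over them in the gnomonic chart -/

section

variable (b : OrthonormalBasis (Fin 3) ℝ E3)

/-- An isosceles triangle, symmetric about the great circle through the first and third frame
vectors, given by its linear inequalities. -/
def isosceles (d h : ℝ) : Set Sph2 :=
  {u | |inner ℝ (b 1) (u : E3)| ≤ inner ℝ (b 2) (u : E3) + 2 * d * inner ℝ (b 0) (u : E3) ∧
    inner ℝ (b 2) (u : E3) ≤ d * h * inner ℝ (b 0) (u : E3)}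

variable {b} {d h : ℝ}

lemma isosceles_pos (hd : 0 < d) (hh : 0 ≤ h) {u : Sph2} (hu : u ∈ isosceles b d h) :
    0 < inner ℝ (b 0) (u : E3) := by
  obtain ⟨h1, h2⟩ := hu
  have h3 := (abs_nonneg _).trans h1
  have h4 : 0 ≤ d * (h + 2) * inner ℝ (b 0) (u : E3) := by linarith
  have h5 : 0 ≤ inner ℝ (b 0) (u : E3) := nonneg_of_mul_nonneg_right h4 (by positivity)
  refine lt_of_le_of_ne h5 fun h0 => ?_
  rw [← h0, mul_zero] at h1 h2
  have e2 : inner ℝ (b 2) (u : E3) = 0 := by linarith [(abs_nonneg _).trans h1]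
  rw [e2, add_zero] at h1
  have e1 : inner ℝ (b 1) (u : E3) = 0 := abs_nonpos_iff.1 h1
  have := norm_coe u
  rw [← frameVec_inner b u.1, ← h0, e1, e2] at this
  simp [frameVec] at this

lemma isConvex_isosceles (hd : 0 < d) (hh : 0 ≤ h) : IsConvex (isosceles b d h) := by
  refine ⟨⟨⟨b 0, by simp⟩, fun u hu => mem_openHemisphere_iff.2 (isosceles_pos hd hh hu)⟩, ?_⟩
  rintro x ⟨hx1, hx2⟩ y ⟨hy1, hy2⟩ z ⟨r, s, hr, hs, hz⟩
  have e : ∀ i, inner ℝ (b i) (z : E3) = r * inner ℝ (b i) (x : E3) + s * inner ℝ (b i) (y : E3) := by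
    intro i; rw [hz, inner_add_right, inner_smul_right, inner_smul_right]
  rw [isosceles, Set.mem_ofPred_eq, e, e, e]
  rw [abs_le] at *
  refine ⟨⟨?_, ?_⟩, ?_⟩
  · nlinarith [mul_le_mul_of_nonneg_left hx1.1 hr, mul_le_mul_of_nonneg_left hy1.1 hs]
  · nlinarith [mul_le_mul_of_nonneg_left hx1.2 hr, mul_le_mul_of_nonneg_left hy1.2 hs]
  · nlinarith [mul_le_mul_of_nonneg_left hx2 hr, mul_le_mul_of_nonneg_left hy2 hs]

lemma IsConvex.add_mem_insert_cone {C : Set Sph2} (hC : IsConvex C) {x y : E3}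
    (hx : x ∈ insert 0 (cone C)) (hy : y ∈ insert 0 (cone C)) : x + y ∈ insert 0 (cone C) := by
  rcases hx with rfl | hx
  · simpa using hy
  rcases hy with rfl | hy
  · simpa using Or.inr hx
  · exact Or.inr (hC.add_mem_cone hx hy)

lemma smul_mem_insert_cone {C : Set Sph2} {x : E3} (hx : x ∈ cone C) {r : ℝ} (hr : 0 ≤ r) :
    r • x ∈ insert 0 (cone C) := by
  rcases hr.eq_or_lt with rfl | hr
  · simp
  · exact Or.inr (smul_mem_cone hx hr)

/-- In the gnomonic chart this is the planar triangle |x| ≤ y + 2d, y ≤ dh, whose vertices are the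
points `q i`. -/
lemma isTriangle_isosceles (hd : 0 < d) (hh : 0 ≤ h) : IsTriangle (isosceles b d h) := by
  set q : Fin 3 → ℝ × ℝ := ![(0, -(2 * d)), (d * (h + 2), d * h), (-(d * (h + 2)), d * h)] with hq
  have hdh : 0 < d * (h + 2) := by positivity
  refine ⟨fun i => gno b (q i), ?_, Set.Subset.antisymm ?_ ?_⟩
  · rw [Fintype.linearIndependent_iff]
    intro g hg
    have e0 := congrArg (fun v => inner ℝ (b 0) v) hg
    have e1 := congrArg (fun v => inner ℝ (b 1) v) hg
    have e2 := congrArg (fun v => inner ℝ (b 2) v) hg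
    simp only [Fin.sum_univ_three, inner_add_right, inner_smul_right, inner_gno_zero,
      inner_gno_one, inner_gno_two, inner_zero_right] at e0 e1 e2
    have w0 := gw_pos (q 0)
    have w1 := gw_pos (q 1)
    have w2 := gw_pos (q 2)
    set a0 := g 0 * gw (q 0) with ha0
    set a1 := g 1 * gw (q 1) with ha1
    set a2 := g 2 * gw (q 2) with ha2
    rw [show (q 0).1 = 0 from rfl, show (q 1).1 = d * (h + 2) from rfl,
      show (q 2).1 = -(d * (h + 2)) from rfl] at e1
    rw [show (q 0).2 = -(2 * d) from rfl, show (q 1).2 = d * h from rfl,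
      show (q 2).2 = d * h from rfl] at e2
    have f1 : d * (h + 2) * (a1 - a2) = 0 := by rw [ha1, ha2]; linarith
    have f2 : -(2 * d) * a0 + d * h * (a1 + a2) = 0 := by rw [ha0, ha1, ha2]; linarith
    have f3 : a1 = a2 := by
      have := (mul_eq_zero.1 f1).resolve_left hdh.ne'; linarith
    have f4 : d * (h + 2) * (a1 + a2) = 0 := by
      have : a0 = -(a1 + a2) := by linarith
      rw [this] at f2; linarith
    have f5 := (mul_eq_zero.1 f4).resolve_left hdh.ne'
    have z0 : a0 = 0 := by linarith
    have z1 : a1 = 0 := by linarith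
    have z2 : a2 = 0 := by linarith
    intro i
    fin_cases i
    · exact (mul_eq_zero.1 z0).resolve_right w0.ne'
    · exact (mul_eq_zero.1 z1).resolve_right w1.ne'
    · exact (mul_eq_zero.1 z2).resolve_right w2.ne'
  · intro u hu C ⟨hC, hpC⟩
    have hv : ∀ i, frameVec b (1, (q i).1, (q i).2) ∈ cone C := by
      intro i
      have h1 : (gno b (q i) : E3) ∈ cone C := coe_mem_cone_iff.2 (hpC ⟨i, rfl⟩)
      rw [coe_gno] at h1
      exact (smul_mem_cone_iff (gw_pos _)).1 h1
    have hu0 := isosceles_pos hd hh hu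
    obtain ⟨h1, h2⟩ := hu
    rw [abs_le] at h1
    set x : ℝ := inner ℝ (b 0) (u : E3)
    set y : ℝ := inner ℝ (b 1) (u : E3)
    set z : ℝ := inner ℝ (b 2) (u : E3)
    set k := d * (h + 2) with hk
    -- The three coefficients are the barycentric coordinates of u up to scale, nonnegative by the
    -- defining inequalities. They may vanish, hence the apex 0 is adjoined to the cone.
    have m0 := smul_mem_insert_cone (hv 0) (r := (d * h * x - z) / k)
      (div_nonneg (by linarith) hdh.le)
    have m1 := smul_mem_insert_cone (hv 1) (r := (z + 2 * d * x + y) / (2 * k))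
      (div_nonneg (by linarith) (by linarith))
    have m2 := smul_mem_insert_cone (hv 2) (r := (z + 2 * d * x - y) / (2 * k))
      (div_nonneg (by linarith) (by linarith))
    have m := hC.add_mem_insert_cone (hC.add_mem_insert_cone m0 m1) m2
    have he : ((d * h * x - z) / k) • frameVec b (1, (q 0).1, (q 0).2) +
        ((z + 2 * d * x + y) / (2 * k)) • frameVec b (1, (q 1).1, (q 1).2) +
        ((z + 2 * d * x - y) / (2 * k)) • frameVec b (1, (q 2).1, (q 2).2) = (u : E3) := by
      rw [← frameVec_smul, ← frameVec_smul, ← frameVec_smul, ← frameVec_add, ← frameVec_add,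
        ← frameVec_inner b u.1]
      congr 1
      have hk' : h + 2 ≠ 0 := by positivity
      ext
      · simp [hq, hk]; change _ = x; field_simp; ring
      · simp [hq, hk]; change _ = y; field_simp; ring
      · simp [hq, hk]; change _ = z; field_simp; ring
    rw [he] at m
    rcases m with h0 | m
    · have := norm_coe u
      rw [h0] at this; simp at this
    · exact coe_mem_cone_iff.1 m
  · refine Set.sInter_subset_of_mem ⟨isConvex_isosceles hd hh, ?_⟩
    rintro _ ⟨i, rfl⟩
    have w := gw_pos (q i)
    rw [isosceles, Set.mem_ofPred_eq, inner_gno_zero, inner_gno_one, inner_gno_two, abs_mul,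
      abs_of_pos w]
    have : |(q i).1| ≤ (q i).2 + 2 * d ∧ (q i).2 ≤ d * h := by
      fin_cases i
      · change |(0 : ℝ)| ≤ -(2 * d) + 2 * d ∧ -(2 * d) ≤ d * h
        exact ⟨by simp, by nlinarith [mul_nonneg hd.le hh]⟩
      · simp [hq, abs_of_pos hd, abs_of_pos (show 0 < h + 2 by linarith)]; linarith
      · simp [hq, abs_of_pos hd, abs_of_pos (show 0 < h + 2 by linarith)]; linarith
    constructor
    · nlinarith [mul_le_mul_of_nonneg_left this.1 w.le]
    · nlinarith [mul_le_mul_of_nonneg_left this.2 w.le]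

lemma setIntegral_eq_gno {A : Set Sph2} (hA : MeasurableSet A)
    (hpos : ∀ u ∈ A, 0 < inner ℝ (b 0) (u : E3)) {F : Sph2 → ℝ} (hF : Continuous F) :
    ∫ u in A, F u ∂σ = ∫ p in gno b ⁻¹' A, gw p ^ 3 * F (gno b p) := by
  have hgA : MeasurableSet (gno b ⁻¹' A) := (continuous_gno b).measurable hA
  have h1 : σ.restrict A = (σ.restrict {u : Sph2 | 0 < inner ℝ (b 0) (u : E3)}).restrict A := by
    rw [Measure.restrict_restrict hA]
    congr 1
    exact (Set.inter_eq_left.2 hpos).symm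
  have hgw := continuous_gw.measurable
  rw [h1, sigma_restrict_eq_map_gno, setIntegral_map hA hF.aestronglyMeasurable
    (continuous_gno b).aemeasurable, setIntegral_withDensity_eq_setIntegral_toReal_smul
    (by fun_prop) (Filter.Eventually.of_forall fun p => ENNReal.ofReal_lt_top) _ hgA]
  refine setIntegral_congr_fun hgA fun p _ => ?_
  simp only [smul_eq_mul]
  rw [ENNReal.toReal_ofReal (pow_nonneg (gw_pos p).le 3)]

/-- A trapezoid (or triangle) of the plane with apex direction `-(2 * d)`. -/
def trapezoid (d y₀ y₁ : ℝ) : Set (ℝ × ℝ) :=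
  {p | p.2 ∈ Set.Icc y₀ y₁ ∧ p.1 ∈ Set.Icc (-(p.2 + 2 * d)) (p.2 + 2 * d)}

lemma setIntegral_trapezoid {d y₀ y₁ : ℝ} (h0 : -(2 * d) ≤ y₀) (h01 : y₀ ≤ y₁) {G : ℝ × ℝ → ℝ}
    (hG : Continuous G) :
    ∫ p in trapezoid d y₀ y₁, G p =
      ∫ y in y₀..y₁, ∫ x in (-(y + 2 * d))..(y + 2 * d), G (x, y) := by
  have hm : MeasurableSet (trapezoid d y₀ y₁) := by
    have h1 : MeasurableSet {p : ℝ × ℝ | -(p.2 + 2 * d) ≤ p.1} :=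
      measurableSet_le (by fun_prop) (by fun_prop)
    have h2 : MeasurableSet {p : ℝ × ℝ | p.1 ≤ p.2 + 2 * d} :=
      measurableSet_le (by fun_prop) (by fun_prop)
    exact (measurable_snd measurableSet_Icc).inter (h1.inter h2)
  have hsub : trapezoid d y₀ y₁ ⊆ Set.Icc (-(y₁ + 2 * d)) (y₁ + 2 * d) ×ˢ Set.Icc y₀ y₁ := by
    rintro p ⟨h1, h2⟩
    exact ⟨⟨by linarith [h2.1, h1.2], by linarith [h2.2, h1.2]⟩, h1⟩
  have hint : IntegrableOn G (trapezoid d y₀ y₁) :=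
    (hG.continuousOn.integrableOn_compact (isCompact_Icc.prod isCompact_Icc)).mono_set hsub
  rw [← integral_indicator hm, Measure.volume_eq_prod,
    integral_prod_symm _ ((integrable_indicator_iff hm).2 hint),
    intervalIntegral.integral_of_le h01, ← integral_Icc_eq_integral_Ioc,
    ← integral_indicator measurableSet_Icc]
  congr 1
  ext y
  by_cases hy : y ∈ Set.Icc y₀ y₁
  · rw [Set.indicator_of_mem hy, intervalIntegral.integral_of_le (by linarith [hy.1]),
      ← integral_Icc_eq_integral_Ioc, ← integral_indicator measurableSet_Icc]
    congr 1
    ext x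
    by_cases hx : x ∈ Set.Icc (-(y + 2 * d)) (y + 2 * d)
    · rw [Set.indicator_of_mem hx, Set.indicator_of_mem (show (x, y) ∈ trapezoid d y₀ y₁ from ⟨hy, hx⟩)]
    · rw [Set.indicator_of_notMem hx, Set.indicator_of_notMem fun h => hx h.2]
  · rw [Set.indicator_of_notMem hy]
    have : ∀ x, (trapezoid d y₀ y₁).indicator G (x, y) = 0 := fun x =>
      Set.indicator_of_notMem (fun h => hy h.1) _
    simp [this]

/-- Integral of a power of the gnomonic density over a horizontal slice of the planar triangle. -/
noncomputable def sliceInt (d : ℝ) (k : ℕ) (y : ℝ) : ℝ :=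
  ∫ x in (-(y + 2 * d))..(y + 2 * d), gw (x, y) ^ k

lemma continuous_sliceInt (d : ℝ) (k : ℕ) : Continuous (sliceInt d k) := by
  have hF : Continuous (Function.uncurry fun y x : ℝ => gw (x, y) ^ k) :=
    (continuous_gw.comp (by fun_prop : Continuous fun p : ℝ × ℝ => (p.2, p.1))).pow k
  have hi : ∀ y a c, IntervalIntegrable (fun x => gw (x, y) ^ k) volume a c := fun y a c =>
    ((continuous_gw.comp (by fun_prop : Continuous fun x : ℝ => (x, y))).pow k).intervalIntegrable _ _
  have : sliceInt d k = fun y => (∫ x in (0 : ℝ)..(y + 2 * d), gw (x, y) ^ k) -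
      ∫ x in (0 : ℝ)..(-(y + 2 * d)), gw (x, y) ^ k := by
    ext y
    rw [intervalIntegral.integral_interval_sub_left (hi _ _ _) (hi _ _ _)]; rfl
  rw [this]
  exact (intervalIntegral.continuous_parametric_intervalIntegral_of_continuous hF (by fun_prop)).sub
    (intervalIntegral.continuous_parametric_intervalIntegral_of_continuous hF (by fun_prop))

lemma gw_le_one (p : ℝ × ℝ) : gw p ≤ 1 := by
  refine inv_le_one_of_one_le₀ (Real.one_le_sqrt.2 ?_)
  nlinarith [sq_nonneg p.1, sq_nonneg p.2]

/-- With s = x² + y² ≤ 20d², the fourth power is (1 + s)⁻² ≥ 1 − 2s ≥ 1 − 40d², and lower powers are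
larger. -/
lemma gw_pow_ge {x y d η : ℝ} (hdη : 40 * d ^ 2 ≤ η) (hx : x ^ 2 ≤ 16 * d ^ 2)
    (hy : y ^ 2 ≤ 4 * d ^ 2) {k : ℕ} (hk : k ≤ 4) : 1 - η ≤ gw (x, y) ^ k := by
  refine le_trans ?_ (pow_le_pow_of_le_one (gw_pos _).le (gw_le_one _) hk)
  have e : gw (x, y) ^ 4 = ((1 + x ^ 2 + y ^ 2) ^ 2)⁻¹ := by
    have : (√(1 + x ^ 2 + y ^ 2)) ^ 2 = 1 + x ^ 2 + y ^ 2 := Real.sq_sqrt (by positivity)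
    rw [gw, inv_pow, show (4 : ℕ) = 2 * 2 by norm_num, pow_mul, this]
  rw [e, ← one_div, le_div_iff₀ (by positivity), add_assoc]
  set s := x ^ 2 + y ^ 2 with hs
  have hs0 : 0 ≤ s := by positivity
  have hs1 : 2 * s ≤ η := by linarith
  calc (1 - η) * (1 + s) ^ 2 ≤ (1 - 2 * s) * (1 + s) ^ 2 := by gcongr
    _ ≤ 1 := by nlinarith [pow_nonneg hs0 2, pow_nonneg hs0 3]

lemma sliceInt_le {d y : ℝ} (k : ℕ) (hy : -(2 * d) ≤ y) : sliceInt d k y ≤ 2 * (y + 2 * d) := by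
  have hi : IntervalIntegrable (fun x => gw (x, y) ^ k) volume (-(y + 2 * d)) (y + 2 * d) :=
    ((continuous_gw.comp (by fun_prop : Continuous fun x : ℝ => (x, y))).pow k).intervalIntegrable _ _
  have := intervalIntegral.integral_mono_on (by linarith) hi
    (intervalIntegrable_const (c := (1 : ℝ))) fun x _ => pow_le_one₀ (gw_pos _).le (gw_le_one _)
  rw [intervalIntegral.integral_const, smul_eq_mul] at this
  unfold sliceInt; linarith

lemma le_sliceInt {d y η : ℝ} {k : ℕ} (hk : k ≤ 4) (hdη : 40 * d ^ 2 ≤ η)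
    (hy : -(2 * d) ≤ y) (hy2 : y ≤ 2 * d) : (1 - η) * (2 * (y + 2 * d)) ≤ sliceInt d k y := by
  have hi : IntervalIntegrable (fun x => gw (x, y) ^ k) volume (-(y + 2 * d)) (y + 2 * d) :=
    ((continuous_gw.comp (by fun_prop : Continuous fun x : ℝ => (x, y))).pow k).intervalIntegrable _ _
  have := intervalIntegral.integral_mono_on (by linarith)
    (intervalIntegrable_const (c := 1 - η)) hi fun x hx => by
      refine gw_pow_ge hdη ?_ ?_ hk
      · nlinarith [hx.1, hx.2]
      · nlinarith
  rw [intervalIntegral.integral_const, smul_eq_mul] at this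
  unfold sliceInt; linarith

end

/-! ### Small triangles with area ratio close to 5/4 -/

section

variable {b : OrthonormalBasis (Fin 3) ℝ E3} {d h : ℝ}

lemma isClosed_isosceles : IsClosed (isosceles b d h) := by
  have h1 : IsClosed {u : Sph2 | |inner ℝ (b 1) (u : E3)| ≤
      inner ℝ (b 2) (u : E3) + 2 * d * inner ℝ (b 0) (u : E3)} :=
    isClosed_le (by fun_prop) (by fun_prop)
  have h2 : IsClosed {u : Sph2 | inner ℝ (b 2) (u : E3) ≤ d * h * inner ℝ (b 0) (u : E3)} :=
    isClosed_le (by fun_prop) (by fun_prop)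
  exact h1.inter h2

lemma gno_mem_isosceles {p : ℝ × ℝ} :
    gno b p ∈ isosceles b d h ↔ p.1 ∈ Set.Icc (-(p.2 + 2 * d)) (p.2 + 2 * d) ∧ p.2 ≤ d * h := by
  have w := gw_pos p
  rw [isosceles, Set.mem_ofPred_eq, inner_gno_zero, inner_gno_one, inner_gno_two, abs_mul,
    abs_of_pos w, Set.mem_Icc, ← abs_le, show gw p * p.2 + 2 * d * gw p = gw p * (p.2 + 2 * d) by ring,
    mul_le_mul_iff_right₀ w, mul_comm (d * h), mul_le_mul_iff_right₀ w]

lemma gno_preimage_isosceles : gno b ⁻¹' isosceles b d h = trapezoid d (-(2 * d)) (d * h) := by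
  ext p
  rw [Set.mem_preimage, gno_mem_isosceles, trapezoid, Set.mem_ofPred_eq]
  constructor
  · rintro ⟨h1, h2⟩; exact ⟨⟨by linarith [h1.1, h1.2], h2⟩, h1⟩
  · rintro ⟨h1, h2⟩; exact ⟨h2, h1.2⟩

lemma height_gno (p : ℝ × ℝ) : height b (gno b p) = gw p * p.2 := inner_gno_two b p

lemma gno_preimage_isosceles_upper (hd : 0 < d) :
    gno b ⁻¹' (isosceles b d h ∩ height b ⁻¹' Set.Ici 0) = trapezoid d 0 (d * h) := by
  rw [Set.preimage_inter, gno_preimage_isosceles]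
  ext p
  have hp : p ∈ gno b ⁻¹' (height b ⁻¹' Set.Ici 0) ↔ 0 ≤ p.2 := by
    change 0 ≤ height b (gno b p) ↔ _
    rw [height_gno, mul_nonneg_iff_of_pos_left (gw_pos p)]
  rw [Set.mem_inter_iff, hp]
  constructor
  · rintro ⟨⟨h1, h2⟩, h3⟩; exact ⟨⟨h3, h1.2⟩, h2⟩
  · rintro ⟨h1, h2⟩; exact ⟨⟨⟨by linarith [h1.1], h1.2⟩, h2⟩, h1.1⟩

lemma gno_preimage_isosceles_lower (hd : 0 < d) (hh : 0 ≤ h) :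
    gno b ⁻¹' (isosceles b d h ∩ height b ⁻¹' Set.Iic 0) = trapezoid d (-(2 * d)) 0 := by
  rw [Set.preimage_inter, gno_preimage_isosceles]
  ext p
  have hp : p ∈ gno b ⁻¹' (height b ⁻¹' Set.Iic 0) ↔ p.2 ≤ 0 := by
    change height b (gno b p) ≤ 0 ↔ _
    rw [height_gno]
    constructor
    · intro h1; by_contra h2; nlinarith [mul_pos (gw_pos p) (not_le.1 h2)]
    · intro h1; exact mul_nonpos_of_nonneg_of_nonpos (gw_pos p).le h1
  rw [Set.mem_inter_iff, hp]
  constructor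
  · rintro ⟨⟨h1, h2⟩, h3⟩; exact ⟨⟨h1.1, h3⟩, h2⟩
  · rintro ⟨h1, h2⟩
    exact ⟨⟨⟨h1.1, h1.2.trans (by positivity)⟩, h2⟩, h1.2⟩

lemma area_of_trapezoid {A : Set Sph2} (hA : MeasurableSet A)
    (hpos : ∀ u ∈ A, 0 < inner ℝ (b 0) (u : E3)) {y₀ y₁ : ℝ} (h0 : -(2 * d) ≤ y₀) (h01 : y₀ ≤ y₁)
    (h : gno b ⁻¹' A = trapezoid d y₀ y₁) : area A = ∫ y in y₀..y₁, sliceInt d 3 y := by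
  have h1 := setIntegral_eq_gno hA hpos (F := fun _ => 1) continuous_const
  rw [setIntegral_const, smul_eq_mul, mul_one, h] at h1
  rw [area, h1]
  simp only [mul_one]
  rw [setIntegral_trapezoid (G := fun p => gw p ^ 3) h0 h01 (continuous_gw.pow 3)]
  rfl

/-- The height of `gno b (x, y)` is y · gw, so the density gw³ becomes gw⁴. -/
lemma isosceles_height_moment (hd : 0 < d) (hh : 0 ≤ h) :
    inner ℝ (b 2) (moment (isosceles b d h)) = ∫ y in (-(2 * d))..(d * h), y * sliceInt d 4 y := by
  rw [inner_moment]
  change ∫ u in isosceles b d h, height b u ∂σ = _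
  rw [setIntegral_eq_gno (b := b) (F := height b) isClosed_isosceles.measurableSet
    (fun u hu => isosceles_pos hd hh hu) continuous_height, gno_preimage_isosceles]
  have e : ∀ p, gw p ^ 3 * height b (gno b p) = p.2 * gw p ^ 4 := fun p => by
    rw [height_gno]; ring
  simp_rw [e]
  have h0 : 0 ≤ d * h := by positivity
  rw [setIntegral_trapezoid (G := fun p => p.2 * gw p ^ 4) le_rfl (by linarith)
    (continuous_snd.mul (continuous_gw.pow 4))]
  simp only [intervalIntegral.integral_const_mul]
  rfl

/-- The triangle is invariant under the reflection that reverses this coordinate. -/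
lemma isosceles_inner_one_moment : inner ℝ (b 1) (moment (isosceles b d h)) = 0 := by
  rw [inner_moment]
  let e : Sph2 := ⟨b 1, by simp⟩
  have hR : ∀ (u : Sph2), (sphMap (reflect e) u : E3) = (u : E3) - (2 * inner ℝ (b 1) (u : E3)) • b 1 :=
    fun u => reflect_apply e u
  have h1 : ∀ u, inner ℝ (b 1) (sphMap (reflect e) u : E3) = -inner ℝ (b 1) (u : E3) := fun u => by
    rw [hR, inner_sub_right, inner_smul_right, b.inner_eq_one]; ring
  have h0 : ∀ u, inner ℝ (b 0) (sphMap (reflect e) u : E3) = inner ℝ (b 0) (u : E3) := fun u => by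
    rw [hR, inner_sub_right, inner_smul_right, b.inner_eq_zero (by decide)]; ring
  have h2 : ∀ u, inner ℝ (b 2) (sphMap (reflect e) u : E3) = inner ℝ (b 2) (u : E3) := fun u => by
    rw [hR, inner_sub_right, inner_smul_right, b.inner_eq_zero (by decide)]; ring
  have hpre : sphMap (reflect e) ⁻¹' isosceles b d h = isosceles b d h := by
    ext u
    simp only [isosceles, Set.mem_preimage, Set.mem_ofPred_eq, h0, h1, h2, abs_neg]
  have hemb : MeasurableEmbedding (sphMap (reflect e)) :=
    (continuous_sphMap _).measurableEmbedding fun u v huv => by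
      have := congrArg (fun w : Sph2 => reflect e (w : E3)) huv
      simp only [sphMap, reflect_reflect] at this
      exact Subtype.ext this
  have key := (measurePreserving_sphMap (reflect e)).setIntegral_preimage_emb hemb
    (fun u => inner ℝ (b 1) (u : E3)) (isosceles b d h)
  rw [hpre] at key
  simp_rw [h1, integral_neg] at key
  linarith

lemma integral_moment_poly (d y₀ y₁ : ℝ) : ∫ y in y₀..y₁, y * (2 * (y + 2 * d)) =
    2 / 3 * (y₁ ^ 3 - y₀ ^ 3) + 2 * d * (y₁ ^ 2 - y₀ ^ 2) := by
  have : ∀ y : ℝ, y * (2 * (y + 2 * d)) = 2 * y ^ 2 + 4 * d * y := fun y => by ring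
  simp_rw [this]
  rw [intervalIntegral.integral_add (Continuous.intervalIntegrable (by fun_prop) _ _)
    (Continuous.intervalIntegrable (by fun_prop) _ _), intervalIntegral.integral_const_mul,
    intervalIntegral.integral_const_mul, integral_pow, integral_id]
  norm_num; ring

lemma integral_area_poly (d y₀ y₁ : ℝ) : ∫ y in y₀..y₁, 2 * (y + 2 * d) =
    (y₁ ^ 2 - y₀ ^ 2) + 4 * d * (y₁ - y₀) := by
  have : ∀ y : ℝ, 2 * (y + 2 * d) = 2 * y + 4 * d := fun y => by ring
  simp_rw [this]
  rw [intervalIntegral.integral_add (Continuous.intervalIntegrable (by fun_prop) _ _)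
    (by simp), intervalIntegral.integral_const_mul, integral_id]
  simp only [intervalIntegral.integral_const, smul_eq_mul]
  ring

/-- Small isosceles triangles with centroid on the equator, whose area ratio is nearly `5 / 4`. -/
lemma exists_isosceles_moment_zero {η : ℝ} (hη0 : 0 < η) (hη1 : η ≤ 1 / 2) (hd : 0 < d)
    (hdη : 40 * d ^ 2 ≤ η) :
    ∃ h, 1 - η ≤ h ∧ h ≤ 2 ∧ ∫ y in (-(2 * d))..(d * h), y * sliceInt d 4 y = 0 := by
  have hc : Continuous fun y => y * sliceInt d 4 y := continuous_id.mul (continuous_sliceInt d 4)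
  have hi : ∀ a c, IntervalIntegrable (fun y => y * sliceInt d 4 y) volume a c := fun a c =>
    hc.intervalIntegrable _ _
  have hpi : ∀ a c, IntervalIntegrable (fun y => y * (2 * (y + 2 * d))) volume a c := fun a c =>
    Continuous.intervalIntegrable (by fun_prop) _ _
  -- The planar moments are −8d³/3 below the equator and d³(2h³/3 + 2h²) above it, balanced at h =
  -- 1; the density changes each by a factor between 1 − η and 1.
  have hlow1 : -(8 / 3 * d ^ 3) ≤ ∫ y in (-(2 * d))..0, y * sliceInt d 4 y := by
    have := intervalIntegral.integral_mono_on (by linarith) (hpi (-(2 * d)) 0) (hi _ _)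
      fun y hy => mul_le_mul_of_nonpos_left (sliceInt_le 4 hy.1) hy.2
    rw [integral_moment_poly] at this
    linarith
  have hlow2 : ∫ y in (-(2 * d))..0, y * sliceInt d 4 y ≤ -((1 - η) * (8 / 3 * d ^ 3)) := by
    have := intervalIntegral.integral_mono_on (by linarith) (hi (-(2 * d)) 0)
      ((hpi (-(2 * d)) 0).const_mul (1 - η))
      fun y hy => (mul_le_mul_of_nonpos_left (le_sliceInt le_rfl hdη hy.1 (by linarith [hy.2])) hy.2).trans_eq
        (mul_left_comm _ _ _)
    rw [intervalIntegral.integral_const_mul, integral_moment_poly] at this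
    linarith
  have hup1 : ∀ h, 0 ≤ h → h ≤ 2 → ∫ y in (0 : ℝ)..(d * h), y * sliceInt d 4 y ≤
      d ^ 3 * (2 / 3 * h ^ 3 + 2 * h ^ 2) := by
    intro h h0 h2
    have := intervalIntegral.integral_mono_on (by positivity) (hi 0 (d * h)) (hpi _ _)
      fun y hy => mul_le_mul_of_nonneg_left (sliceInt_le 4 (by linarith [hy.1])) hy.1
    rw [integral_moment_poly] at this
    linarith
  have hup2 : (1 - η) * (d ^ 3 * (40 / 3)) ≤ ∫ y in (0 : ℝ)..(d * 2), y * sliceInt d 4 y := by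
    have := intervalIntegral.integral_mono_on (by positivity)
      ((hpi 0 (d * 2)).const_mul (1 - η)) (hi _ _)
      fun y hy => (mul_left_comm _ _ _).trans_le
        (mul_le_mul_of_nonneg_left (le_sliceInt le_rfl hdη (by linarith [hy.1]) (by linarith [hy.2])) hy.1)
    rw [intervalIntegral.integral_const_mul, integral_moment_poly] at this
    linarith
  set F : ℝ → ℝ := fun h => ∫ y in (-(2 * d))..(d * h), y * sliceInt d 4 y with hF
  have hFc : Continuous F :=
    (intervalIntegral.continuous_primitive hi (-(2 * d))).comp (continuous_const.mul continuous_id)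
  have hsplit : ∀ h, F h = (∫ y in (-(2 * d))..0, y * sliceInt d 4 y) +
      ∫ y in (0 : ℝ)..(d * h), y * sliceInt d 4 y := fun h =>
    (intervalIntegral.integral_add_adjacent_intervals (hi _ _) (hi _ _)).symm
  have hd3 : 0 < d ^ 3 := by positivity
  have hF0 : F 0 ≤ 0 := by
    rw [hsplit, mul_zero, intervalIntegral.integral_same, add_zero]
    nlinarith
  have hF2 : 0 ≤ F 2 := by
    rw [hsplit]; nlinarith
  obtain ⟨h, ⟨h0, h2⟩, hFh⟩ := intermediate_value_Icc (by norm_num : (0 : ℝ) ≤ 2) hFc.continuousOn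
    ⟨hF0, hF2⟩
  refine ⟨h, ?_, h2, hFh⟩
  by_contra hcon
  push Not at hcon
  have h3 := hup1 h h0 h2
  rw [hsplit] at hFh
  -- For h ≤ 1 the right side is at most 8h/3, so h < 1 − η would leave too little moment above the
  -- equator.
  have h4 : (1 - η) * (8 / 3) ≤ 2 / 3 * h ^ 3 + 2 * h ^ 2 := by
    have : d ^ 3 * ((1 - η) * (8 / 3)) ≤ d ^ 3 * (2 / 3 * h ^ 3 + 2 * h ^ 2) := by linarith
    exact le_of_mul_le_mul_left this hd3
  have h5 : h ^ 2 ≤ h := by nlinarith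
  have h6 : h ^ 3 ≤ h := by nlinarith
  linarith

/-- The planar areas are 4d² below and d²(h² + 4h) above, with h² + 4h ≥ 5(1 − η)². A further factor
1 − η pays for the density. -/
lemma isosceles_area_ratio {η : ℝ} (hη1 : η ≤ 1 / 2) (hd : 0 < d)
    (hdη : 40 * d ^ 2 ≤ η) (hh : 1 - η ≤ h) (hh2 : h ≤ 2) :
    0 < area (isosceles b d h ∩ height b ⁻¹' Set.Iic 0) ∧
      (1 - η) ^ 3 * (5 / 4) * area (isosceles b d h ∩ height b ⁻¹' Set.Iic 0) ≤
        area (isosceles b d h ∩ height b ⁻¹' Set.Ici 0) := by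
  have h0 : 0 ≤ h := by linarith
  have hdh : 0 ≤ d * h := by positivity
  have hm := (isClosed_isosceles (b := b) (d := d) (h := h)).measurableSet
  have hp := fun u hu => isosceles_pos (b := b) (u := u) hd h0 hu
  have hi : ∀ a c, IntervalIntegrable (sliceInt d 3) volume a c := fun a c =>
    (continuous_sliceInt d 3).intervalIntegrable _ _
  have hpi : ∀ a c, IntervalIntegrable (fun y => 2 * (y + 2 * d)) volume a c := fun a c =>
    Continuous.intervalIntegrable (by fun_prop) _ _
  have e1 := area_of_trapezoid (d := d) (hm.inter (continuous_height.measurable measurableSet_Iic))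
    (fun u hu => hp u hu.1) le_rfl (by linarith) (gno_preimage_isosceles_lower hd h0)
  have e2 := area_of_trapezoid (d := d) (hm.inter (continuous_height.measurable measurableSet_Ici))
    (fun u hu => hp u hu.1) (by linarith) hdh (gno_preimage_isosceles_upper hd)
  have l1 := intervalIntegral.integral_mono_on (by linarith) (hi (-(2 * d)) 0) (hpi _ _)
      fun y hy => sliceInt_le 3 hy.1
  have l2 := intervalIntegral.integral_mono_on (by linarith) ((hpi (-(2 * d)) 0).const_mul (1 - η))
      (hi _ _) fun y hy => le_sliceInt (by norm_num) hdη hy.1 (by linarith [hy.2])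
  have l3 := intervalIntegral.integral_mono_on hdh ((hpi 0 (d * h)).const_mul (1 - η))
      (hi _ _) fun y hy => le_sliceInt (by norm_num) hdη (by linarith [hy.1])
        (by nlinarith [hy.2])
  rw [intervalIntegral.integral_const_mul, integral_area_poly] at l2 l3
  rw [integral_area_poly] at l1
  rw [e1, e2]
  have hd2 : 0 < d ^ 2 := by positivity
  refine ⟨lt_of_lt_of_le ?_ l2, ?_⟩
  · have : 0 < (1 - η) * (4 * d ^ 2) := mul_pos (by linarith) (by positivity)
    linarith
  refine le_trans (mul_le_mul_of_nonneg_left l1 ?_) (le_trans ?_ l3)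
  · have : 0 ≤ 1 - η := by linarith
    positivity
  have key : (1 - η) ^ 2 * 5 ≤ h ^ 2 + 4 * h := by
    have hη : 0 < η := lt_of_lt_of_le (by positivity) hdη
    nlinarith
  have hfin : (1 - η) * d ^ 2 * ((1 - η) ^ 2 * 5) ≤ (1 - η) * d ^ 2 * (h ^ 2 + 4 * h) :=
    mul_le_mul_of_nonneg_left key (mul_nonneg (by linarith) hd2.le)
  linarith

/-- Spherical triangles with given centroid on the equator and area ratio nearly `5 / 4`. -/
lemma exists_triangle (b : OrthonormalBasis (Fin 3) ℝ E3) {c : Sph2} (hc : (c : E3) = b 0) {η : ℝ}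
    (hη0 : 0 < η) (hη1 : η ≤ 1 / 2) :
    ∃ T, IsTriangle T ∧ IsCentroid T c ∧ 0 < area (T ∩ height b ⁻¹' Set.Iic 0) ∧
      (1 - η) ^ 3 * (5 / 4) * area (T ∩ height b ⁻¹' Set.Iic 0) ≤
        area (T ∩ height b ⁻¹' Set.Ici 0) := by
  have hd : 0 < η / 10 := by positivity
  have hdη : 40 * (η / 10) ^ 2 ≤ η := by nlinarith
  obtain ⟨h, hh1, hh2, hz⟩ := exists_isosceles_moment_zero hη0 hη1 hd hdη
  have h0 : 0 ≤ h := by linarith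
  set d := η / 10
  obtain ⟨ha, hr⟩ := isosceles_area_ratio (b := b) hη1 hd hdη hh1 hh2
  have hm := (isClosed_isosceles (b := b) (d := d) (h := h)).measurableSet
  have hσ : 0 < σ (isosceles b d h) := by
    rw [area, measureReal_def] at ha
    exact lt_of_lt_of_le (ENNReal.toReal_pos_iff.1 ha).1 (measure_mono Set.inter_subset_left)
  have hmom0 : 0 < inner ℝ (b 0) (moment (isosceles b d h)) := by
    rw [inner_moment, setIntegral_pos_iff_support_of_nonneg_ae _
      (integrable_of_continuous (by fun_prop)).integrableOn]
    · exact lt_of_lt_of_le hσ (measure_mono fun u hu => ⟨(isosceles_pos hd h0 hu).ne', hu⟩)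
    · filter_upwards [ae_restrict_mem hm] with u hu
      exact (isosceles_pos hd h0 hu).le
  have hmom : moment (isosceles b d h) = inner ℝ (b 0) (moment (isosceles b d h)) • b 0 := by
    conv_lhs => rw [← frameVec_inner b (moment (isosceles b d h))]
    rw [isosceles_inner_one_moment, isosceles_height_moment hd h0, hz]
    simp [frameVec]
  refine ⟨_, isTriangle_isosceles hd h0, ⟨hm, hσ, ?_, ?_⟩, ha, hr⟩
  · intro h1; rw [h1] at hmom0; simp at hmom0
  · rw [hc]
    set m : ℝ := inner ℝ (b 0) (moment (isosceles b d h))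
    rw [hmom, norm_smul, b.norm_eq_one, mul_one, Real.norm_of_nonneg hmom0.le,
      inv_smul_smul₀ hmom0.ne']

end

/-! ### Hemispheres bounded by L, the adapted frame, and the conclusion -/

lemma inner_eq_zero_of_frontier {u : Sph2} {W : Submodule ℝ E3}
    (h : frontier (closedHemisphere u) = {x : Sph2 | (x : E3) ∈ W}) {x : E3} (hx : x ∈ W) :
    inner ℝ (u : E3) x = 0 := by
  by_cases h0 : x = 0
  · rw [h0, inner_zero_right]
  have hn := norm_pos_iff.2 h0
  have hmem : (⟨‖x‖⁻¹ • x, by rw [mem_sphere_zero_iff_norm, norm_smul, norm_inv, norm_norm,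
      inv_mul_cancel₀ hn.ne']⟩ : Sph2) ∈ {x : Sph2 | (x : E3) ∈ W} := W.smul_mem _ hx
  have hset : closedHemisphere u = {x : Sph2 | 0 ≤ inner ℝ (u : E3) (x : E3)} :=
    Set.ext fun _ => mem_closedHemisphere_iff
  rw [← h, hset] at hmem
  have h1 := frontier_le_subset_eq (continuous_const : Continuous fun _ : Sph2 => (0 : ℝ))
    (by fun_prop : Continuous fun x : Sph2 => inner ℝ (u : E3) (x : E3)) hmem
  have h2 : 0 = inner ℝ (u : E3) (‖x‖⁻¹ • x) := h1
  rw [inner_smul_right] at h2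
  exact (mul_eq_zero.1 h2.symm).resolve_left (inv_ne_zero hn.ne')

/-- Both centres are unit vectors in the orthogonal complement of W, which is a line. -/
lemma eq_neg_of_frontier {u v : Sph2} {W : Submodule ℝ E3} (hW : Module.finrank ℝ W = 2)
    (hu : frontier (closedHemisphere u) = {x : Sph2 | (x : E3) ∈ W})
    (hv : frontier (closedHemisphere v) = {x : Sph2 | (x : E3) ∈ W}) (huv : u ≠ v) :
    (u : E3) = -(v : E3) := by
  have hperp : ∀ w : Sph2, frontier (closedHemisphere w) = {x : Sph2 | (x : E3) ∈ W} →
      (w : E3) ∈ Wᗮ := fun w hw =>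
    (Submodule.mem_orthogonal' W _).2 fun x hx => inner_eq_zero_of_frontier hw hx
  have hrank : Module.finrank ℝ Wᗮ = 1 := by
    have := Submodule.finrank_add_finrank_orthogonal W
    rw [hW, finrank_euclideanSpace_fin] at this
    omega
  have hv0 : (⟨v, hperp v hv⟩ : Wᗮ) ≠ 0 := by
    intro h
    have h1 : (v : E3) = 0 := congrArg Subtype.val h
    have := norm_coe v
    rw [h1] at this; simp at this
  obtain ⟨r, hr⟩ := (finrank_eq_one_iff_of_nonzero' _ hv0).1 hrank ⟨u, hperp u hu⟩
  have hr' : r • (v : E3) = (u : E3) := congrArg Subtype.val hr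
  have hn := congrArg norm hr'
  rw [norm_smul, norm_coe, norm_coe, mul_one, Real.norm_eq_abs] at hn
  rcases eq_or_eq_neg_of_abs_eq hn with rfl | rfl
  · exact absurd (Subtype.ext (by rw [← hr', one_smul])) huv
  · rw [← hr', neg_one_smul]

lemma exists_frame {c n : Sph2} (h : inner ℝ (n : E3) (c : E3) = 0) :
    ∃ b : OrthonormalBasis (Fin 3) ℝ E3, b 0 = c ∧ b 2 = n := by
  have hon : Orthonormal ℝ (Set.domRestrict {0, 2} (![(c : E3), 0, n] : Fin 3 → E3)) := by
    rw [orthonormal_iff_ite]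
    rintro ⟨i, hi⟩ ⟨j, hj⟩
    rcases hi with rfl | rfl <;> rcases hj with rfl | rfl
    · change inner ℝ (c : E3) (c : E3) = _; simp
    · change inner ℝ (c : E3) (n : E3) = _
      rw [if_neg fun e => absurd (congrArg Subtype.val e) (by decide), real_inner_comm, h]
    · change inner ℝ (n : E3) (c : E3) = _
      rw [if_neg fun e => absurd (congrArg Subtype.val e) (by decide), h]
    · change inner ℝ (n : E3) (n : E3) = _; simp
  obtain ⟨b, hb⟩ := hon.exists_orthonormalBasis_extension_of_card_eq (by simp)
  exact ⟨b, by simpa using hb 0 (by simp), by simpa using hb 2 (by simp)⟩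

end Sph2

theorem mainTheorem11 (K : Set Sph2) (hK : Sph2.IsConvexDisk K)
    (c : Sph2) (hc : Sph2.IsCentroid K c)
    (L : Set Sph2) (hL : Sph2.IsGreatCircle L) (hcL : c ∈ L)
    (S₁ S₂ : Set Sph2)
    (hS₁ : ∃ u : Sph2, S₁ = Sph2.closedHemisphere u) (hS₁L : frontier S₁ = L)
    (hS₂ : ∃ u : Sph2, S₂ = Sph2.closedHemisphere u) (hS₂L : frontier S₂ = L)
    (hS : S₁ ≠ S₂) :
    ∃ T : Set Sph2, Sph2.IsTriangle T ∧ Sph2.IsCentroid T c ∧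
      Sph2.area (K ∩ S₂) / Sph2.area (K ∩ S₁) ≤ Sph2.area (T ∩ S₂) / Sph2.area (T ∩ S₁) := by
  obtain ⟨W, hW, rfl⟩ := hL
  obtain ⟨u, rfl⟩ := hS₁
  obtain ⟨n, rfl⟩ := hS₂
  have hun := Sph2.eq_neg_of_frontier hW hS₁L hS₂L fun h => hS (by rw [h])
  have hnc := Sph2.inner_eq_zero_of_frontier hS₂L hcL
  obtain ⟨b, hb0, hb2⟩ := Sph2.exists_frame hnc
  have hS₂' : Sph2.closedHemisphere n = Sph2.height b ⁻¹' Set.Ici 0 := by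
    ext x
    rw [Sph2.mem_closedHemisphere_iff, ← hb2]; rfl
  have hS₁' : Sph2.closedHemisphere u = Sph2.height b ⁻¹' Set.Iic 0 := by
    ext x
    rw [Sph2.mem_closedHemisphere_iff, hun, inner_neg_left, neg_nonneg, ← hb2]; rfl
  have hframe : Sph2.InFrame b K :=
    ⟨hK, fun x hx => hb0 ▸ hK.inner_centroid_pos hc hx, hb0 ▸ hK.centroid_mem_interior_cone hc⟩
  obtain ⟨hA, hlt⟩ := hframe.area_lt (by rw [hb2, hc.moment_eq, inner_smul_right, hnc, mul_zero])
  rw [hS₁', hS₂']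
  set ρ := Sph2.area (K ∩ Sph2.height b ⁻¹' Set.Ici 0) /
    Sph2.area (K ∩ Sph2.height b ⁻¹' Set.Iic 0) with hρ
  have hρ1 : ρ < 5 / 4 := by rwa [hρ, div_lt_iff₀ hA]
  -- Since (1 − η)³ ≥ 1 − 3η, the last condition gives (1 − η)³ · 5/4 ≥ ρ.
  obtain ⟨η, hη0, hη1, hη2⟩ : ∃ η : ℝ, 0 < η ∧ η ≤ 1 / 2 ∧ 3 * η ≤ 1 - 4 / 5 * ρ :=
    ⟨min (1 / 2) ((1 - 4 / 5 * ρ) / 3), lt_min (by norm_num) (by linarith), min_le_left _ _, by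
      linarith [min_le_right (1 / 2) ((1 - 4 / 5 * ρ) / 3)]⟩
  obtain ⟨T, hT, hTc, hT0, hTr⟩ := Sph2.exists_triangle b hb0.symm hη0 hη1
  refine ⟨T, hT, hTc, ?_⟩
  rw [le_div_iff₀ hT0]
  refine le_trans (mul_le_mul_of_nonneg_right ?_ hT0.le) hTr
  nlinarith [sq_nonneg η, pow_pos hη0 2, mul_pos hη0 hη0]
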